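/- Let $q$ be a prime power and let $m,s\ge 1$ be integers with $s\mid m$ and $m/s\ge 3$; assume $m\ge 4$ if $q\ne 2$ and $m\ge 6$ if $q=2$. Put $n=\frac{q^m-1}{q^s-1}$ and let $\beta\in\mathbb F_{q^m}$ be a primitive $n$-th root of unity. For $i\in\mathbb Z$ let $m_i(x)$ be the minimal polynomial of $\beta^i$ over $\mathbb F_q$. For integers $b$ and $\delta$ with $2\le\delta\le n$ let $\mathcal C_{(\delta,b)}\subseteq\mathbb F_q^n$ be the cyclic code of length $n$ with generator polynomial $\operatorname{lcm}(m_b(x),m_{b+1}(x),\dots,m_{b+\delta-2}(x))$; these codes are the BCH codes with respect to $\beta$. Put $\mathcal C_\delta=\mathcal C_{(\delta,1)}$. A code is called dually-BCH if both it and its dual (for the standard inner product) are BCH codes with respect to $\beta$. The $q$-cyclotomic coset of $a$ modulo $n$ ($0\le a<n$) is $\{aq^k \bmod n: k\ge 0\}\subseteq\{0,\dots,n-1\}$, and its smallest element is its coset leader. Let $\delta_1$ be the largest $q$-cyclotomic coset leader modulo $n$, and let $2\le\delta\le n$. 1. If $q=2$ and $s=1$, put $\delta_2=2^{m-1}-2^{\lfloor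 (m-1)/2\rfloor}-1$. Then $\delta_2$ is the second largest $2$-cyclotomic coset leader modulo $n=2^m-1$, and $\mathcal C_\delta$ is dually-BCH if and only if $\delta\in\{2,3\}$ or $\delta_2+1\le\delta\le n$. 2. If $q>2$ or $s>1$, then $\mathcal C_\delta$ is dually-BCH if and only if $\delta_1<\delta\le n$. -/

import Mathlib

open Polynomial

noncomputable section

namespace BCH

/-- The `q`-cyclotomic coset of `a` modulo `n`, represented in `{0, …, n - 1}`. -/
def cyclotomicCoset (q n a : ℕ) : Set ℕ :=
  {x | ∃ k : ℕ, x = (a * q ^ k) % n}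

/-- `a ∈ {0, …, n - 1}` is a coset leader: the smallest element of its `q`-cyclotomic coset
modulo `n`. -/
def IsCosetLeader (q n a : ℕ) : Prop :=
  a < n ∧ IsLeast (cyclotomicCoset q n a) a

variable {F K : Type*} [Field F] [Field K] [Algebra F K]

/-- The generator polynomial `lcm (m_b, m_{b+1}, …, m_{b+δ-2})`, where `m_i` is the minimal
polynomial of `β ^ i` over `F`. The least common multiple is the monic one. -/
def genPoly (F : Type*) {K : Type*} [Field F] [Field K] [Algebra F K]
    (β : K) (δ : ℕ) (b : ℤ) : F[X] :=
  letI : DecidableEq F := Classical.decEq F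
  letI : NormalizedGCDMonoid F[X] := UniqueFactorizationMonoid.toNormalizedGCDMonoid F[X]
  (Finset.Icc b (b + (δ : ℤ) - 2)).lcm fun i : ℤ => minpoly F (β ^ i)

/-- The identification of `(c_0, …, c_{n-1})` with the class of `c_0 + c_1 X + ⋯ + c_{n-1} X^{n-1}`
in `F[X] / (X^n - 1)`. -/
def wordToQuotient (F : Type*) [Field F] (n : ℕ) :
    (Fin n → F) →ₗ[F] F[X] ⧸ Ideal.span {(X ^ n - 1 : F[X])} :=
  (Ideal.Quotient.mkₐ F (Ideal.span {(X ^ n - 1 : F[X])})).toLinearMap ∘ₗ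
    ∑ i : Fin n, (Polynomial.monomial (R := F) (i : ℕ)) ∘ₗ LinearMap.proj i

/-- The cyclic code of length `n` corresponding to the ideal of `F[X] / (X^n - 1)` generated
by the class of `g`. -/
def cyclicCode (n : ℕ) (g : F[X]) : Submodule F (Fin n → F) :=
  ((Ideal.span {Ideal.Quotient.mk (Ideal.span {(X ^ n - 1 : F[X])}) g}).restrictScalars F).comap
    (wordToQuotient F n)

/-- The dual code with respect to the standard inner product. -/
def dualCode {n : ℕ} (C : Submodule F (Fin n → F)) : Submodule F (Fin n → F) where
  carrier := {x | ∀ c ∈ C, x ⬝ᵥ c = 0}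
  add_mem' hx hy c hc := by rw [add_dotProduct, hx c hc, hy c hc, add_zero]
  zero_mem' c _ := zero_dotProduct c
  smul_mem' a x hx c hc := by rw [smul_dotProduct, hx c hc, smul_zero]

/-- The code `C_(δ,b)` over `F` of length `n` with respect to `β`. -/
def bchCode (F : Type*) {K : Type*} [Field F] [Field K] [Algebra F K]
    (n : ℕ) (β : K) (δ : ℕ) (b : ℤ) : Submodule F (Fin n → F) :=
  cyclicCode n (genPoly F β δ b)

/-- The narrow-sense code `C_δ = C_(δ,1)`. -/
def narrowBCHCode (F : Type*) {K : Type*} [Field F] [Field K] [Algebra F K]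
    (n : ℕ) (β : K) (δ : ℕ) : Submodule F (Fin n → F) :=
  bchCode F n β δ 1

/-- `C` is a BCH code with respect to `β`. -/
def IsBCHCode {n : ℕ} (β : K) (C : Submodule F (Fin n → F)) : Prop :=
  ∃ (δ : ℕ) (b : ℤ), 2 ≤ δ ∧ δ ≤ n ∧ C = bchCode F n β δ b

/-- `C` is a dually-BCH code with respect to `β`: both `C` and its dual are BCH codes with respect
to `β`. -/
def IsDuallyBCH {n : ℕ} (β : K) (C : Submodule F (Fin n → F)) : Prop :=
  IsBCHCode β C ∧ IsBCHCode β (dualCode C)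

end BCH

end

/-! A code cut out by a Frobenius-closed set `S` of `n`-th roots of unity determines `S`, and its
dual is cut out by the roots whose inverses lie outside `S` (`zeroCode_le_iff`,
`dualCode_zeroCode`). The narrow-sense code omits the zero `1` and has the zero `β`. Hence the dual
has the zero `1` but not `β⁻¹`, so an interval of exponents describing the dual must start at a
multiple of `n`. The question becomes one about cosets: is there a `v` such that, for every `a` not
divisible by `n`, the coset of `a` meets `[0, v]` exactly when the coset of `-a` misses `[0, δ -
1]`?

Put `Q = q ^ s`, `R_j = 1 + Q + ⋯ + Q ^ (j - 1)`, so `n = R_r` with `r = m / s`, and `D = δ - 1`.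
Negation sends the coset of `R_j` to that of `R_(r-j)`. If `D` and `v` are both at least `R_t`,
these pairs force the smaller of the two below `R_(r-r/2)` and the larger below `R_(r-t)`. An
integer `z` whose conjugates are all at least `R_(r-r/2)`, while those of `-z` are all at least
`R_(r-t)`, is then a contradiction (`not_exchange`). Such a `z` is found by prescribing the base-`q`
digits of `(Q - 1) z`: multiplication by `q` rotates them, so it suffices that long cyclic windows
contain a nonzero digit and short ones a digit other than `q - 1` (`exists_forall_le_conj`).

In general `t = 1` works, leaving only `δ > δ₁`, where the dual has the single zero `1`. For `q =
2`, `s = 1` only `t = 2` is available, so the cases with `D` or `v` at most `2` survive. They come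
from `-1` lying in the coset of `δ₁` and from the two largest coset leaders. -/

noncomputable section

namespace BCH

/-! ### Codes given by their zeros, and their duals -/

section Codes

variable {F K : Type*} [Field F] [Field K] [Algebra F K]

/-- The value at `x` of the polynomial with coefficient vector `c`. -/
def wordEval {n : ℕ} (c : Fin n → F) (x : K) : K :=
  ∑ i, algebraMap F K (c i) * x ^ (i : ℕ)

/-- The words whose polynomials vanish on `S`. -/
def zeroCode (F : Type*) {K : Type*} [Field F] [Field K] [Algebra F K] (n : ℕ) (S : Set K) :
    Submodule F (Fin n → F) where
  carrier := {c | ∀ x ∈ S, wordEval c x = 0}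
  add_mem' {c d} hc hd x hx := by
    have h1 := hc x hx
    have h2 := hd x hx
    simp only [wordEval] at h1 h2 ⊢
    simp [add_mul, Finset.sum_add_distrib, h1, h2]
  zero_mem' x _ := by simp [wordEval]
  smul_mem' a c hc x hx := by
    have h1 := hc x hx
    simp only [wordEval] at h1 ⊢
    simp [mul_assoc, ← Finset.mul_sum, h1]

theorem mem_zeroCode {n : ℕ} {S : Set K} {c : Fin n → F} :
    c ∈ zeroCode F n S ↔ ∀ x ∈ S, wordEval c x = 0 := Iff.rfl

theorem mem_dualCode {n : ℕ} {C : Submodule F (Fin n → F)} {x : Fin n → F} :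
    x ∈ dualCode C ↔ ∀ c ∈ C, x ⬝ᵥ c = 0 := Iff.rfl

theorem mem_cyclicCode {n : ℕ} {g : F[X]} (hg : g ∣ X ^ n - 1) (c : Fin n → F) :
    c ∈ cyclicCode n g ↔ g ∣ ∑ i : Fin n, monomial (i : ℕ) (c i) := by
  have h : c ∈ cyclicCode n g ↔ Ideal.Quotient.mk (Ideal.span {(X ^ n - 1 : F[X])})
      (∑ i : Fin n, monomial (i : ℕ) (c i)) ∈
      Ideal.span {Ideal.Quotient.mk (Ideal.span {(X ^ n - 1 : F[X])}) g} := by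
    simp [cyclicCode, wordToQuotient]
  rw [h, Ideal.mem_span_singleton]
  constructor
  · rintro ⟨y, hy⟩
    obtain ⟨y, rfl⟩ := Ideal.Quotient.mk_surjective y
    rw [← map_mul, Ideal.Quotient.eq, Ideal.mem_span_singleton] at hy
    exact (dvd_sub_left (dvd_mul_right g y)).1 (hg.trans hy)
  · exact fun h => map_dvd _ h

theorem aeval_word {n : ℕ} (c : Fin n → F) (x : K) :
    aeval x (∑ i : Fin n, monomial (i : ℕ) (c i)) = wordEval c x := by
  simp [wordEval, aeval_monomial]

theorem genPoly_dvd_iff (β : K) (δ : ℕ) (b : ℤ) (p : F[X]) :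
    genPoly F β δ b ∣ p ↔ ∀ i ∈ Finset.Icc b (b + (δ : ℤ) - 2), aeval (β ^ i) p = 0 := by
  let : DecidableEq F := Classical.decEq F
  let : NormalizedGCDMonoid F[X] := UniqueFactorizationMonoid.toNormalizedGCDMonoid F[X]
  change (Finset.Icc b (b + (δ : ℤ) - 2)).lcm (fun i : ℤ => minpoly F (β ^ i)) ∣ p ↔ _
  rw [Finset.lcm_dvd_iff]
  simp only [minpoly.dvd_iff]

theorem mem_bchCode {n : ℕ} {β : K} (hβ : β ^ n = 1) (δ : ℕ) (b : ℤ) (c : Fin n → F) :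
    c ∈ bchCode F n β δ b ↔
      ∀ i ∈ Finset.Icc b (b + (δ : ℤ) - 2), wordEval c (β ^ i) = 0 := by
  unfold bchCode
  rw [mem_cyclicCode, genPoly_dvd_iff]
  · simp only [aeval_word]
  · rw [genPoly_dvd_iff]
    intro i _
    simp only [map_sub, map_pow, aeval_X, map_one]
    rw [← zpow_natCast, ← zpow_mul, mul_comm, zpow_mul, zpow_natCast, hβ, one_zpow, sub_self]

theorem wordEval_pow_natCard [Finite F] {n : ℕ} (c : Fin n → F) (x : K) (k : ℕ) :
    wordEval c (x ^ Nat.card F ^ k) = wordEval c x ^ Nat.card F ^ k := by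
  have := Fintype.ofFinite F
  rw [Nat.card_eq_fintype_card]
  induction k with
  | zero => simp
  | succ k ih =>
    have h (y : K) : wordEval c (y ^ Fintype.card F) = wordEval c y ^ Fintype.card F := by
      have := map_sum (FiniteField.frobeniusAlgHom F K)
        (fun i : Fin n => algebraMap F K (c i) * y ^ (i : ℕ)) Finset.univ
      simp only [map_mul, AlgHom.commutes, map_pow, FiniteField.frobeniusAlgHom_apply] at this
      simp only [wordEval, this]
    rw [pow_succ, pow_mul, h, ih, ← pow_mul]

/-- The `q`-conjugates of `β ^ b, …, β ^ (b + δ - 2)`. -/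
def bchZeros (q : ℕ) (β : K) (δ : ℕ) (b : ℤ) : Set K :=
  {x | ∃ i ∈ Finset.Icc b (b + (δ : ℤ) - 2), ∃ k : ℕ, x = (β ^ i) ^ q ^ k}

theorem bchCode_eq_zeroCode [Finite F] {n : ℕ} {β : K} (hβ : β ^ n = 1) (δ : ℕ) (b : ℤ) :
    bchCode F n β δ b = zeroCode F n (bchZeros (Nat.card F) β δ b) := by
  ext c
  rw [mem_bchCode hβ, mem_zeroCode]
  constructor
  · rintro h x ⟨i, hi, k, rfl⟩
    rw [wordEval_pow_natCard, h i hi, zero_pow]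
    exact pow_ne_zero _ Nat.card_pos.ne'
  · exact fun h i hi => h _ ⟨i, hi, 0, by simp⟩

variable [Finite F] [FiniteDimensional F K]

theorem pow_natCard_pow_finrank_mul (x : K) (k : ℕ) :
    x ^ Nat.card F ^ (Module.finrank F K * k) = x := by
  have : Finite K := Module.finite_of_finite F
  have := Fintype.ofFinite K
  rw [pow_mul, ← Module.natCard_eq_pow_finrank, Nat.card_eq_fintype_card]
  exact FiniteField.pow_card_pow k x

theorem sum_fin_pow_eq_zero {n : ℕ} {y : K} (h1 : y ^ n = 1) (hy : y ≠ 1) :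
    ∑ i : Fin n, y ^ (i : ℕ) = 0 := by
  rw [Fin.sum_univ_eq_sum_range (fun i => y ^ i), geom_sum_eq hy, h1, sub_self, zero_div]

/-- The word `(Tr (γ u ^ i))_i`. -/
def traceWord (F : Type*) {K : Type*} [Field F] [Field K] [Algebra F K] (n : ℕ) (γ u : K) :
    Fin n → F :=
  fun i => Algebra.trace F K (γ * u ^ (i : ℕ))

theorem wordEval_traceWord (n : ℕ) (γ u x : K) :
    wordEval (traceWord F n γ u) x = ∑ k ∈ Finset.range (Module.finrank F K),
      γ ^ Nat.card F ^ k * ∑ i : Fin n, (u ^ Nat.card F ^ k * x) ^ (i : ℕ) := by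
  have : Finite K := Module.finite_of_finite F
  simp only [wordEval, traceWord, FiniteField.algebraMap_trace_eq_sum_pow, Finset.sum_mul,
    Finset.mul_sum]
  rw [Finset.sum_comm]
  refine Finset.sum_congr rfl fun k _ => Finset.sum_congr rfl fun i _ => ?_
  rw [mul_pow, mul_pow, ← pow_mul, ← pow_mul, mul_comm (i : ℕ)]
  ring

/-- Evaluating a trace word at `x` gives geometric sums with ratios `u ^ q ^ k * x`. Each vanishes
unless `x` is a conjugate of `u⁻¹`. -/
theorem traceWord_mem_zeroCode {n : ℕ} {S : Set K} (hS : ∀ x ∈ S, x ^ n = 1)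
    (hq : ∀ x ∈ S, ∀ k : ℕ, x ^ Nat.card F ^ k ∈ S) {u : K} (hu : u ^ n = 1) (huS : u⁻¹ ∉ S)
    (γ : K) : traceWord F n γ u ∈ zeroCode F n S := by
  intro x hx
  rw [wordEval_traceWord]
  refine Finset.sum_eq_zero fun k _ => ?_
  rw [sum_fin_pow_eq_zero, mul_zero]
  · rw [mul_pow, hS x hx, mul_one, ← pow_mul, mul_comm, pow_mul, hu, one_pow]
  · intro h
    apply huS
    have h2 : x = u⁻¹ ^ Nat.card F ^ k := by
      rw [inv_pow]
      exact eq_inv_of_mul_eq_one_right h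
    -- This further power of Frobenius undoes the `k`-th one, Frobenius having order dividing
    -- `finrank F K`.
    have h3 := hq x hx (k * (Module.finrank F K - 1))
    rw [h2, ← pow_mul, ← pow_add] at h3
    have h4 : k + k * (Module.finrank F K - 1) = Module.finrank F K * k := by
      have : 0 < Module.finrank F K := Module.finrank_pos
      obtain ⟨r, hr⟩ := Nat.exists_eq_succ_of_ne_zero this.ne'
      rw [hr]; simp; ring
    rwa [h4, pow_natCard_pow_finrank_mul] at h3

/-- Trace words with `u = x⁻¹` lie in the code. Expanding `x⁻¹ ^ i` in a basis, whose coordinates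
are traces against the dual basis, writes `n = ∑ x⁻¹ ^ i * x ^ i` as a combination of their values
at `x`, so not all of these vanish. -/
theorem exists_mem_zeroCode_wordEval_ne_zero {n : ℕ} (hn : (n : K) ≠ 0) {S : Set K}
    (hS : ∀ x ∈ S, x ^ n = 1) (hq : ∀ x ∈ S, ∀ k : ℕ, x ^ Nat.card F ^ k ∈ S) {x : K}
    (hx : x ^ n = 1) (hxS : x ∉ S) : ∃ c ∈ zeroCode F n S, wordEval c x ≠ 0 := by
  by_contra! h
  have hn0 : n ≠ 0 := by rintro rfl; simp at hn
  have hx0 : x ≠ 0 := by rintro rfl; simp [hn0] at hx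
  have h1 (γ : K) : wordEval (traceWord F n γ x⁻¹) x = 0 :=
    h _ (traceWord_mem_zeroCode hS hq (by rw [inv_pow, hx, inv_one]) (by rwa [inv_inv]) γ)
  let e := Module.finBasis F K
  let B := (Algebra.traceForm F K).toDual (traceForm_nondegenerate F K)
  have h2 (l) (y : K) : Algebra.trace F K (B.symm (e.coord l) * y) = e.coord l y := by
    have := LinearMap.BilinForm.toDual_def (traceForm_nondegenerate F K)
      (m := B.symm (e.coord l)) (n := y)
    rw [Algebra.traceForm_apply] at this
    rw [← this]
    change B (B.symm (e.coord l)) y = _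
    rw [LinearEquiv.apply_symm_apply]
  apply hn
  calc (n : K) = ∑ i : Fin n, x⁻¹ ^ (i : ℕ) * x ^ (i : ℕ) := by
        simp only [← mul_pow, inv_mul_cancel₀ hx0, one_pow]
        simp
    _ = ∑ i : Fin n, (∑ l, e.coord l (x⁻¹ ^ (i : ℕ)) • e l) * x ^ (i : ℕ) := by
        simp only [Module.Basis.coord_apply, Module.Basis.sum_repr]
    _ = ∑ l, e l * wordEval (traceWord F n (B.symm (e.coord l)) x⁻¹) x := by
        simp only [wordEval, traceWord, h2, Finset.sum_mul, Finset.mul_sum]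
        rw [Finset.sum_comm]
        refine Finset.sum_congr rfl fun k _ => Finset.sum_congr rfl fun i _ => ?_
        rw [Algebra.smul_def]; ring
    _ = 0 := by simp [h1]

theorem zeroCode_le_iff {n : ℕ} (hn : (n : K) ≠ 0) {S T : Set K}
    (hS : ∀ x ∈ S, x ^ n = 1) (hT : ∀ x ∈ T, x ^ n = 1)
    (hq : ∀ x ∈ S, ∀ k : ℕ, x ^ Nat.card F ^ k ∈ S) :
    zeroCode F n S ≤ zeroCode F n T ↔ T ⊆ S := by
  constructor
  · intro h x hx
    by_contra hxS
    obtain ⟨c, hc, hcx⟩ := exists_mem_zeroCode_wordEval_ne_zero (F := F) hn hS hq (hT x hx) hxS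
    exact hcx (h hc x hx)
  · exact fun h c hc x hx => hc x (h hx)

/-- Orthogonality to all trace words at `y` forces vanishing at `y`, by nondegeneracy of the trace
form. Conversely, Parseval's identity writes `n` times the inner product as a sum over roots of
unity in which each term has a zero factor. -/
theorem dualCode_zeroCode {n : ℕ} (hn : (n : K) ≠ 0) {β : K} (hβ : IsPrimitiveRoot β n)
    {S : Set K} (hS : ∀ x ∈ S, x ^ n = 1) (hq : ∀ x ∈ S, ∀ k : ℕ, x ^ Nat.card F ^ k ∈ S) :
    dualCode (zeroCode F n S) = zeroCode F n {x : K | x ^ n = 1 ∧ x⁻¹ ∉ S} := by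
  have hn0 : n ≠ 0 := by rintro rfl; simp at hn
  ext x
  rw [mem_dualCode, mem_zeroCode]
  constructor
  · rintro h y ⟨hy, hyS⟩
    refine (traceForm_nondegenerate F K).1 _ fun γ => ?_
    have := h _ (traceWord_mem_zeroCode hS hq hy hyS γ)
    rw [Algebra.traceForm_apply, ← this, wordEval, Finset.sum_mul, map_sum]
    refine Finset.sum_congr rfl fun i _ => ?_
    rw [traceWord, mul_assoc, ← Algebra.smul_def, map_smul, smul_eq_mul, mul_comm γ]
  · intro h c hc
    apply FaithfulSMul.algebraMap_injective F K
    apply mul_left_cancel₀ hn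
    rw [map_zero, mul_zero]
    have hβ0 : β ≠ 0 := hβ.ne_zero hn0
    have hr (t : ℕ) : (β ^ t) ^ n = 1 := by
      rw [← pow_mul, mul_comm, pow_mul, hβ.pow_eq_one, one_pow]
    have key : ∑ j : Fin n, wordEval x (β ^ (j : ℕ)) * wordEval c ((β ^ (j : ℕ))⁻¹)
        = n * algebraMap F K (x ⬝ᵥ c) := by
      simp only [wordEval, Finset.sum_mul_sum, dotProduct, map_sum, map_mul]
      rw [Finset.mul_sum]
      rw [Finset.sum_comm]
      refine Finset.sum_congr rfl fun i _ => ?_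
      rw [Finset.sum_comm]
      have h1 (i' : Fin n) : ∑ j : Fin n, algebraMap F K (x i) * (β ^ (j : ℕ)) ^ (i : ℕ) *
          (algebraMap F K (c i') * (β ^ (j : ℕ))⁻¹ ^ (i' : ℕ)) =
          if i' = i then n * (algebraMap F K (x i) * algebraMap F K (c i)) else 0 := by
        have h2 (j : Fin n) : algebraMap F K (x i) * (β ^ (j : ℕ)) ^ (i : ℕ) *
          (algebraMap F K (c i') * (β ^ (j : ℕ))⁻¹ ^ (i' : ℕ)) =
          algebraMap F K (x i) * algebraMap F K (c i') *
            (β ^ (i : ℕ) * (β ^ (i' : ℕ))⁻¹) ^ (j : ℕ) := by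
          rw [mul_pow, inv_pow, inv_pow, ← pow_mul, ← pow_mul, ← pow_mul, ← pow_mul,
            mul_comm (j : ℕ), mul_comm (j : ℕ)]
          ring
        simp only [h2, ← Finset.mul_sum]
        split_ifs with hi
        · subst hi
          rw [mul_inv_cancel₀ (pow_ne_zero _ hβ0)]
          simp [mul_comm]
        · rw [sum_fin_pow_eq_zero, mul_zero]
          · rw [mul_pow, inv_pow, hr, hr, inv_one, mul_one]
          · rw [Ne, mul_inv_eq_one₀ (pow_ne_zero _ hβ0)]
            exact fun h => hi (Fin.ext (hβ.pow_inj i'.2 i.2 h.symm))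
      simp only [h1]
      simp
    rw [← key]
    refine Finset.sum_eq_zero fun j _ => ?_
    by_cases hjS : (β ^ (j : ℕ))⁻¹ ∈ S
    · rw [hc _ hjS, mul_zero]
    · rw [h _ ⟨hr j, hjS⟩, zero_mul]

end Codes

/-! ### Arithmetic of cyclotomic cosets -/

/-- Some element of the `q`-cyclotomic coset of `a` modulo `n` is at most `t`. -/
def HasConjLE (q n : ℕ) (a : ℤ) (t : ℕ) : Prop :=
  ∃ k : ℕ, (a * (q : ℤ) ^ k) % n ≤ t

section Cosets

variable {q n m : ℕ}

theorem pow_mul_sub_one_modEq (hqn : (q : ℤ) ^ m ≡ 1 [ZMOD n]) (hm : 0 < m) (a : ℤ) (k : ℕ) :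
    a * (q : ℤ) ^ k * (q : ℤ) ^ (k * (m - 1)) ≡ a [ZMOD n] := by
  have h : k + k * (m - 1) = m * k := by
    obtain ⟨r, rfl⟩ := Nat.exists_eq_succ_of_ne_zero hm.ne'
    simp; ring
  rw [mul_assoc, ← pow_add, h, pow_mul]
  simpa using (hqn.pow k).mul_left a

theorem not_dvd_mul_pow (hqn : (q : ℤ) ^ m ≡ 1 [ZMOD n]) (hm : 0 < m) {a : ℤ}
    (ha : ¬ (n : ℤ) ∣ a) (k : ℕ) : ¬ (n : ℤ) ∣ a * (q : ℤ) ^ k := fun h =>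
  ha ((pow_mul_sub_one_modEq hqn hm a k).dvd_iff.1 (h.mul_right _))

theorem emod_le_self_of_nonneg {a : ℤ} (n : ℕ) (ha : 0 ≤ a) : a % n ≤ a := by
  lift a to ℕ using ha
  exact_mod_cast Nat.mod_le a n

theorem HasConjLE.mono {a : ℤ} {t u : ℕ} (h : HasConjLE q n a t) (htu : t ≤ u) :
    HasConjLE q n a u := by
  obtain ⟨k, hk⟩ := h
  exact ⟨k, hk.trans (by exact_mod_cast htu)⟩

theorem hasConjLE_congr (hqn : (q : ℤ) ^ m ≡ 1 [ZMOD n]) (hm : 0 < m) {a b : ℤ} {j : ℕ}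
    (h : b ≡ a * (q : ℤ) ^ j [ZMOD n]) (t : ℕ) : HasConjLE q n a t ↔ HasConjLE q n b t := by
  constructor
  · rintro ⟨k, hk⟩
    refine ⟨j * (m - 1) + k, ?_⟩
    have h1 := (h.mul_right ((q : ℤ) ^ (j * (m - 1)))).trans (pow_mul_sub_one_modEq hqn hm a j)
    have h2 := h1.mul_right ((q : ℤ) ^ k)
    rw [mul_assoc, ← pow_add] at h2
    rw [h2]
    exact hk
  · rintro ⟨k, hk⟩
    refine ⟨j + k, ?_⟩
    have h2 := h.mul_right ((q : ℤ) ^ k)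
    rw [mul_assoc, ← pow_add] at h2
    rw [← h2]
    exact hk

end Cosets

/-! ### Zeros of BCH codes in terms of cosets -/

section Zeros

variable {K : Type*} [Field K] {q n m : ℕ} {β : K}

theorem zpow_mem_bchZeros_iff (hβ : IsPrimitiveRoot β n) (hn : 0 < n)
    (hqn : (q : ℤ) ^ m ≡ 1 [ZMOD n]) (hm : 0 < m) (a : ℤ) (δ : ℕ) (b : ℤ) :
    β ^ a ∈ bchZeros q β δ b ↔
      ∃ i ∈ Finset.Icc b (b + (δ : ℤ) - 2), ∃ k : ℕ, a * (q : ℤ) ^ k ≡ i [ZMOD n] := by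
  have h0 : β ≠ 0 := hβ.ne_zero hn.ne'
  have key (i : ℤ) (k : ℕ) : β ^ a = (β ^ i) ^ q ^ k ↔ a ≡ i * (q : ℤ) ^ k [ZMOD n] := by
    rw [← zpow_natCast (β ^ i), ← zpow_mul, Nat.cast_pow, ← div_eq_one_iff_eq (zpow_ne_zero _ h0),
      ← zpow_sub₀ h0, hβ.zpow_eq_one_iff_dvd, ← Int.modEq_iff_dvd]
    exact ⟨fun h => h.symm, fun h => h.symm⟩
  constructor
  · rintro ⟨i, hi, k, hk⟩
    rw [key] at hk
    exact ⟨i, hi, k * (m - 1),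
      (hk.mul_right _).trans (pow_mul_sub_one_modEq hqn hm i k)⟩
  · rintro ⟨i, hi, k, hk⟩
    refine ⟨i, hi, k * (m - 1), ?_⟩
    rw [key]
    exact (pow_mul_sub_one_modEq hqn hm a k).symm.trans (hk.mul_right _)

theorem zpow_mem_bchZeros_of_dvd_iff (hβ : IsPrimitiveRoot β n) (hn : 0 < n)
    (hqn : (q : ℤ) ^ m ≡ 1 [ZMOD n]) (hm : 0 < m) (a : ℤ) {δ : ℕ} (hδ : 2 ≤ δ) {b : ℤ}
    (hb : (n : ℤ) ∣ b) : β ^ a ∈ bchZeros q β δ b ↔ HasConjLE q n a (δ - 2) := by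
  have hn' : (0 : ℤ) < n := by exact_mod_cast hn
  rw [zpow_mem_bchZeros_iff hβ hn hqn hm]
  constructor
  · rintro ⟨i, hi, k, hk⟩
    refine ⟨k, ?_⟩
    rw [Finset.mem_Icc] at hi
    have h1 : i ≡ i - b [ZMOD n] := by
      rw [Int.modEq_iff_dvd]
      simpa using hb
    rw [hk.trans h1]
    have h2 := Int.emod_nonneg (i - b) hn'.ne'
    have := emod_le_self_of_nonneg (a := i - b) n (by lia)
    lia
  · rintro ⟨k, hk⟩
    refine ⟨b + (a * (q : ℤ) ^ k) % n, ?_, k, ?_⟩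
    · have := Int.emod_nonneg (a * (q : ℤ) ^ k) hn'.ne'
      rw [Finset.mem_Icc]
      lia
    · have h1 := (Int.modEq_zero_iff_dvd.2 hb).add_right ((a * (q : ℤ) ^ k) % n)
      rw [zero_add] at h1
      exact (h1.trans (Int.mod_modEq _ _)).symm

/-- The exponents run over `1, …, δ - 1`. Residue `0` must be excluded, since it would satisfy the
bound without being an exponent. -/
theorem zpow_mem_bchZeros_one_iff (hβ : IsPrimitiveRoot β n) (hn : 0 < n)
    (hqn : (q : ℤ) ^ m ≡ 1 [ZMOD n]) (hm : 0 < m) {a : ℤ} (ha : ¬ (n : ℤ) ∣ a) {δ : ℕ}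
    (hδ : 2 ≤ δ) : β ^ a ∈ bchZeros q β δ 1 ↔ HasConjLE q n a (δ - 1) := by
  have hn' : (0 : ℤ) < n := by exact_mod_cast hn
  rw [zpow_mem_bchZeros_iff hβ hn hqn hm]
  constructor
  · rintro ⟨i, hi, k, hk⟩
    refine ⟨k, ?_⟩
    rw [Finset.mem_Icc] at hi
    rw [hk]
    have := emod_le_self_of_nonneg (a := i) n (by lia)
    lia
  · rintro ⟨k, hk⟩
    refine ⟨(a * (q : ℤ) ^ k) % n, ?_, k, (Int.mod_modEq _ _).symm⟩
    have h1 := Int.emod_nonneg (a * (q : ℤ) ^ k) hn'.ne'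
    have h2 : (a * (q : ℤ) ^ k) % n ≠ 0 := fun h =>
      not_dvd_mul_pow hqn hm ha k (Int.dvd_of_emod_eq_zero h)
    rw [Finset.mem_Icc]
    lia

theorem pow_eq_one_of_mem_bchZeros (hβ : β ^ n = 1) {δ : ℕ} {b : ℤ} {x : K}
    (hx : x ∈ bchZeros q β δ b) : x ^ n = 1 := by
  obtain ⟨i, -, k, rfl⟩ := hx
  rw [← pow_mul, mul_comm, pow_mul, ← zpow_natCast (β ^ i), ← zpow_mul, mul_comm, zpow_mul,
    zpow_natCast, hβ, one_zpow, one_pow]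

theorem pow_mem_bchZeros {δ : ℕ} {b : ℤ} {x : K} (hx : x ∈ bchZeros q β δ b) (k : ℕ) :
    x ^ q ^ k ∈ bchZeros q β δ b := by
  obtain ⟨i, hi, j, rfl⟩ := hx
  exact ⟨i, hi, j + k, by rw [← pow_mul, pow_add]⟩

theorem one_notMem_bchZeros (hβ : IsPrimitiveRoot β n) (hn : 0 < n)
    (hqn : (q : ℤ) ^ m ≡ 1 [ZMOD n]) (hm : 0 < m) {δ : ℕ} (hδn : δ ≤ n) :
    (1 : K) ∉ bchZeros q β δ 1 := by
  rw [← zpow_zero β, zpow_mem_bchZeros_iff hβ hn hqn hm]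
  rintro ⟨i, hi, k, hk⟩
  rw [Finset.mem_Icc] at hi
  rw [zero_mul, Int.modEq_iff_dvd, sub_zero] at hk
  have := Int.le_of_dvd (by lia) hk
  lia

end Zeros

/-! ### Reduction of the dually-BCH property to cosets -/

variable {F K : Type*} [Field F] [Field K] [Algebra F K] [Finite F] [FiniteDimensional F K]

theorem natCard_pow_finrank_modEq_one {n : ℕ} {β : K} (hβ : IsPrimitiveRoot β n) (hn : 0 < n) :
    (Nat.card F : ℤ) ^ Module.finrank F K ≡ 1 [ZMOD n] := by
  have h := pow_natCard_pow_finrank_mul (F := F) β 1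
  rw [mul_one] at h
  have h1 : β ^ ((Nat.card F : ℤ) ^ Module.finrank F K - 1) = 1 := by
    rw [zpow_sub₀ (hβ.ne_zero hn.ne'), zpow_one, div_eq_one_iff_eq (hβ.ne_zero hn.ne')]
    rw [← Nat.cast_pow, zpow_natCast, h]
  rw [hβ.zpow_eq_one_iff_dvd] at h1
  exact ((Int.modEq_iff_dvd).2 h1).symm

theorem natCast_ne_zero_of_isPrimitiveRoot (F : Type*) {K : Type*} [Field F] [Field K]
    [Algebra F K] [Finite F] [FiniteDimensional F K] {n : ℕ} {β : K} (hβ : IsPrimitiveRoot β n)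
    (hn : 0 < n) : (n : K) ≠ 0 := by
  intro h0
  obtain ⟨c, hc⟩ := (natCard_pow_finrank_modEq_one (F := F) hβ hn).symm.dvd
  have h1 : (((Nat.card F : ℤ) ^ Module.finrank F K - 1 : ℤ) : K) = ((n * c : ℤ) : K) := by
    rw [hc]
  have : Finite K := Module.finite_of_finite F
  have := Fintype.ofFinite K
  have h2 : ((Nat.card F : K)) ^ Module.finrank F K = 0 := by
    have := FiniteField.cast_card_eq_zero K
    rwa [← Nat.card_eq_fintype_card, Module.natCard_eq_pow_finrank (K := F), Nat.cast_pow] at this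
  push_cast at h1
  rw [h2, h0] at h1
  simp at h1

/-- The narrow-sense code is dually-BCH when passing to negatives exchanges a lower segment and an
upper segment of the ordered set of cosets. -/
theorem isDuallyBCH_narrowBCHCode_iff {n : ℕ} {β : K} (hβ : IsPrimitiveRoot β n) {δ : ℕ}
    (hδ : 2 ≤ δ) (hδn : δ ≤ n) :
    IsDuallyBCH β (narrowBCHCode F n β δ) ↔ ∃ v : ℕ, v + 2 ≤ n ∧ ∀ a : ℤ, ¬ (n : ℤ) ∣ a →
      (HasConjLE (Nat.card F) n a v ↔ ¬ HasConjLE (Nat.card F) n (-a) (δ - 1)) := by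
  have hn : 0 < n := by lia
  have hn' : (0 : ℤ) < n := by exact_mod_cast hn
  have hm : 0 < Module.finrank F K := Module.finrank_pos
  have hqn := natCard_pow_finrank_modEq_one (F := F) hβ hn
  have hnK := natCast_ne_zero_of_isPrimitiveRoot F hβ hn
  set q := Nat.card F with hq
  have h0 : β ≠ 0 := hβ.ne_zero hn.ne'
  set T : Set K := {x : K | x ^ n = 1 ∧ x⁻¹ ∉ bchZeros q β δ 1} with hT
  have hdual : dualCode (narrowBCHCode F n β δ) = zeroCode F n T := by
    rw [narrowBCHCode, bchCode_eq_zeroCode hβ.pow_eq_one, dualCode_zeroCode hnK hβ]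
    · exact fun x hx => pow_eq_one_of_mem_bchZeros hβ.pow_eq_one hx
    · exact fun x hx k => pow_mem_bchZeros hx k
  have hzpow (a : ℤ) : (β ^ a) ^ n = 1 := by
    rw [← zpow_natCast, ← zpow_mul, mul_comm, zpow_mul, zpow_natCast, hβ.pow_eq_one, one_zpow]
  have hTa {a : ℤ} (ha : ¬ (n : ℤ) ∣ a) : β ^ a ∈ T ↔ ¬ HasConjLE q n (-a) (δ - 1) := by
    rw [hT, Set.mem_ofPred_eq, ← zpow_neg, zpow_mem_bchZeros_one_iff hβ hn hqn hm (by simpa) hδ]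
    simp [hzpow]
  have hT1 : (1 : K) ∈ T := by
    rw [hT, Set.mem_ofPred_eq, inv_one]
    exact ⟨one_pow n, one_notMem_bchZeros hβ hn hqn hm hδn⟩
  have hTq : ∀ x ∈ T, ∀ k : ℕ, x ^ q ^ k ∈ T := by
    rintro x ⟨hx1, hx2⟩ k
    refine ⟨by rw [← pow_mul, mul_comm, pow_mul, hx1, one_pow], fun h => hx2 ?_⟩
    have := pow_mem_bchZeros h (k * (Module.finrank F K - 1))
    have h4 : k + k * (Module.finrank F K - 1) = Module.finrank F K * k := by
      obtain ⟨r, hr⟩ := Nat.exists_eq_succ_of_ne_zero hm.ne'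
      rw [hr]; simp; ring
    rwa [← inv_pow, ← pow_mul, ← pow_add, h4, pow_natCard_pow_finrank_mul] at this
  have hcode (δ' : ℕ) (b : ℤ) :
      dualCode (narrowBCHCode F n β δ) = bchCode F n β δ' b ↔ T = bchZeros q β δ' b := by
    rw [hdual, bchCode_eq_zeroCode hβ.pow_eq_one]
    have hB : ∀ x ∈ bchZeros q β δ' b, x ^ n = 1 := fun x hx =>
      pow_eq_one_of_mem_bchZeros hβ.pow_eq_one hx
    constructor
    · intro h
      exact Set.Subset.antisymm
        ((zeroCode_le_iff hnK hB (fun x hx => hx.1) fun x hx k => pow_mem_bchZeros hx k).1 h.ge)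
        ((zeroCode_le_iff hnK (fun x hx => hx.1) hB hTq).1 h.le)
    · intro h
      rw [h]
  have hself : IsBCHCode β (narrowBCHCode F n β δ) := ⟨δ, 1, hδ, hδn, rfl⟩
  rw [IsDuallyBCH, and_iff_right hself, IsBCHCode]
  simp only [hcode]
  constructor
  · rintro ⟨δ', b, hδ', hδ'n, h⟩
    refine ⟨δ' - 2, by lia, fun a ha => ?_⟩
    rw [← hTa ha, h]
    have h1 := hT1
    rw [h, ← zpow_zero β, zpow_mem_bchZeros_iff hβ hn hqn hm] at h1
    obtain ⟨i, hi, k, hk⟩ := h1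
    rw [zero_mul, Int.modEq_iff_dvd, sub_zero] at hk
    -- `i` is a multiple of `n` in the interval. If the interval began earlier, `i - 1` would make
    -- `β⁻¹` a zero of the dual, although `β` is a zero of the code.
    have hib : i = b := by
      by_contra hne
      rw [Finset.mem_Icc] at hi
      have h2 : β ^ (-1 : ℤ) ∈ bchZeros q β δ' b := by
        rw [zpow_mem_bchZeros_iff hβ hn hqn hm]
        refine ⟨i - 1, by rw [Finset.mem_Icc]; lia, 0, ?_⟩
        rw [Int.modEq_iff_dvd]
        simpa using hk
      have hn1 : ¬ (n : ℤ) ∣ -1 := fun h => by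
        have := Int.le_of_dvd one_pos ((dvd_neg (α := ℤ)).1 h)
        lia
      rw [← h, hTa hn1] at h2
      refine h2 ⟨0, ?_⟩
      rw [neg_neg, one_mul, pow_zero, Int.emod_eq_of_lt (by lia) (by lia)]
      lia
    subst hib
    exact (zpow_mem_bchZeros_of_dvd_iff hβ hn hqn hm a hδ' hk).symm
  · rintro ⟨v, hv, h⟩
    -- Designed distance `v + 2` from `b = 0` gives exactly the exponents `0, …, v`.
    refine ⟨v + 2, 0, by lia, hv, ?_⟩
    have hmem (a : ℤ) : β ^ a ∈ T ↔ β ^ a ∈ bchZeros q β (v + 2) 0 := by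
      rw [zpow_mem_bchZeros_of_dvd_iff hβ hn hqn hm a (by lia) (dvd_zero _), Nat.add_sub_cancel]
      by_cases ha : (n : ℤ) ∣ a
      · rw [(hβ.zpow_eq_one_iff_dvd a).2 ha]
        refine iff_of_true hT1 ⟨0, ?_⟩
        rw [pow_zero, mul_one, Int.emod_eq_zero_of_dvd ha]
        lia
      · rw [hTa ha, h a ha]
    have : NeZero n := ⟨hn.ne'⟩
    ext x
    constructor
    · intro hx
      obtain ⟨i, -, rfl⟩ := hβ.eq_pow_of_pow_eq_one hx.1
      rw [← zpow_natCast] at hx ⊢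
      exact (hmem i).1 hx
    · intro hx
      obtain ⟨i, -, rfl⟩ := hβ.eq_pow_of_pow_eq_one (pow_eq_one_of_mem_bchZeros hβ.pow_eq_one hx)
      rw [← zpow_natCast] at hx ⊢
      exact (hmem i).2 hx

/-! ### Repunits and the obstruction to exchanging segments -/

/-- The repunit `1 + Q + ⋯ + Q ^ (j - 1)`. -/
def repunit (Q j : ℕ) : ℕ := ∑ i ∈ Finset.range j, Q ^ i

theorem repunit_mul (Q j : ℕ) (hQ : 1 ≤ Q) : repunit Q j * (Q - 1) + 1 = Q ^ j := by
  obtain ⟨p, rfl⟩ := Nat.exists_eq_add_of_le' hQ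
  simpa [repunit] using geom_sum_mul_add p j

theorem repunit_add (Q i j : ℕ) : repunit Q (i + j) = repunit Q i + Q ^ i * repunit Q j := by
  simp [repunit, Finset.sum_range_add, pow_add, Finset.mul_sum]

theorem repunit_strictMono {Q : ℕ} (hQ : 1 ≤ Q) : StrictMono (repunit Q) := by
  refine strictMono_nat_of_lt_succ fun j => ?_
  rw [repunit, repunit, Finset.sum_range_succ]
  have : 0 < Q ^ j := pow_pos hQ j
  lia

theorem pow_modEq_one_repunit {q s r : ℕ} (hq : 1 ≤ q) :
    (q : ℤ) ^ (s * r) ≡ 1 [ZMOD repunit (q ^ s) r] := by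
  have h := repunit_mul (q ^ s) r (Nat.one_le_pow _ _ hq)
  refine Int.ModEq.symm ((Int.modEq_iff_dvd).2 ⟨((q ^ s - 1 : ℕ) : ℤ), ?_⟩)
  rw [pow_mul]
  have h' : ((repunit (q ^ s) r * (q ^ s - 1) + 1 : ℕ) : ℤ) = ((q ^ s) ^ r : ℕ) := by rw [h]
  push_cast at h' ⊢
  linarith

theorem hasConjLE_repunit {q n : ℕ} (t : ℕ) : HasConjLE q n t t :=
  ⟨0, by simpa using emod_le_self_of_nonneg n (by positivity : (0 : ℤ) ≤ t)⟩

/-- With `Q = q ^ s`, splitting `R_r = R_j + Q ^ j * R_(r-j)` and multiplying by `Q ^ (r - j)` gives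
`-R_j * Q ^ (r - j) ≡ R_(r-j)` modulo `R_r`, as `Q ^ r ≡ 1`. -/
theorem hasConjLE_neg_repunit {q s r j : ℕ} (hq : 1 ≤ q) (hj : j ≤ r) :
    HasConjLE q (repunit (q ^ s) r) (-(repunit (q ^ s) j : ℤ)) (repunit (q ^ s) (r - j)) := by
  refine ⟨s * (r - j), ?_⟩
  have h1 := repunit_add (q ^ s) j (r - j)
  rw [Nat.add_sub_cancel' hj] at h1
  have h2 : -(repunit (q ^ s) j : ℤ) * (q : ℤ) ^ (s * (r - j)) ≡
      repunit (q ^ s) (r - j) [ZMOD repunit (q ^ s) r] := by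
    have h3 := (pow_modEq_one_repunit (s := s) (r := r) hq).mul_right (repunit (q ^ s) (r - j) : ℤ)
    rw [one_mul] at h3
    refine Int.ModEq.trans ?_ h3
    refine (Int.modEq_iff_dvd).2 ⟨(q : ℤ) ^ (s * (r - j)), ?_⟩
    have h4 : s * r = s * j + s * (r - j) := by rw [← mul_add, Nat.add_sub_cancel' hj]
    rw [h4, h1]
    push_cast
    rw [pow_add, pow_mul _ s j]
    ring
  rw [h2]
  exact emod_le_self_of_nonneg _ (by positivity)

theorem not_dvd_repunit {Q r j : ℕ} (hQ : 1 ≤ Q) (hj : 0 < j) (hjr : j < r) :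
    ¬ (repunit Q r : ℤ) ∣ repunit Q j := by
  intro h
  have h1 := repunit_strictMono hQ hj
  have h2 := repunit_strictMono hQ hjr
  have := Nat.le_of_dvd (by lia) (Int.natCast_dvd_natCast.1 h)
  lia

theorem not_exchange_of_le {q s r t v D : ℕ} (hq : 1 ≤ q) (hr : 2 ≤ r) (ht : 0 < t) (htr : t < r)
    (hD : repunit (q ^ s) t ≤ D) (hDv : D ≤ v) (z : ℤ)
    (hz : ∀ k : ℕ, (repunit (q ^ s) (r - r / 2) : ℤ) ≤ (z * (q : ℤ) ^ k) % repunit (q ^ s) r ∧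
      (repunit (q ^ s) (r - t) : ℤ) ≤ (-z * (q : ℤ) ^ k) % repunit (q ^ s) r)
    (H : ∀ a : ℤ, ¬ (repunit (q ^ s) r : ℤ) ∣ a → (HasConjLE q (repunit (q ^ s) r) a v ↔
      ¬ HasConjLE q (repunit (q ^ s) r) (-a) D)) : False := by
  have hQ : 1 ≤ q ^ s := Nat.one_le_pow _ _ hq
  -- Otherwise `a = -R_(r-r/2)`, which is conjugate to `R_(r/2)`, has a conjugate at most `v` while
  -- `-a` is already at most `D`.
  have h1 : D < repunit (q ^ s) (r - r / 2) := by
    by_contra! h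
    have h2 := (hasConjLE_neg_repunit (s := s) (r := r) (j := r - r / 2) hq (by lia)).mono
      (u := v) (((repunit_strictMono hQ).monotone (by lia)).trans (h.trans hDv))
    rw [H _ (by rw [dvd_neg]; exact not_dvd_repunit hQ (by lia) (by lia)), neg_neg] at h2
    exact h2 ((hasConjLE_repunit _).mono h)
  have h2 : v < repunit (q ^ s) (r - t) := by
    by_contra! h
    have h2 := (hasConjLE_neg_repunit (s := s) (r := r) (j := t) hq (by lia)).mono (u := v) h
    rw [H _ (by rw [dvd_neg]; exact not_dvd_repunit hQ ht htr), neg_neg] at h2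
    exact h2 ((hasConjLE_repunit _).mono hD)
  have hz0 : ¬ (repunit (q ^ s) r : ℤ) ∣ -z := by
    rw [dvd_neg]
    intro h
    have h3 := (hz 0).1
    rw [pow_zero, mul_one, Int.emod_eq_zero_of_dvd h] at h3
    lia
  have h3 : HasConjLE q (repunit (q ^ s) r) (-z) v := by
    rw [H _ hz0, neg_neg]
    rintro ⟨k, hk⟩
    have := (hz k).1
    lia
  obtain ⟨k, hk⟩ := h3
  have := (hz k).2
  lia

/-- The exchange condition is symmetric in `v` and `D` under `a ↦ -a`, so `D ≤ v` may be assumed. -/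
theorem not_exchange {q s r t v D : ℕ} (hq : 1 ≤ q) (hr : 2 ≤ r) (ht : 0 < t) (htr : t < r)
    (hD : repunit (q ^ s) t ≤ D) (hv : repunit (q ^ s) t ≤ v) (z : ℤ)
    (hz : ∀ k : ℕ, (repunit (q ^ s) (r - r / 2) : ℤ) ≤ (z * (q : ℤ) ^ k) % repunit (q ^ s) r ∧
      (repunit (q ^ s) (r - t) : ℤ) ≤ (-z * (q : ℤ) ^ k) % repunit (q ^ s) r) :
    ¬ ∀ a : ℤ, ¬ (repunit (q ^ s) r : ℤ) ∣ a → (HasConjLE q (repunit (q ^ s) r) a v ↔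
      ¬ HasConjLE q (repunit (q ^ s) r) (-a) D) := by
  intro H
  rcases le_total D v with h | h
  · exact not_exchange_of_le hq hr ht htr hD h z hz H
  · refine not_exchange_of_le hq hr ht htr hv h z hz fun a ha => ?_
    have := H (-a) (by rwa [dvd_neg])
    rw [neg_neg] at this
    tauto

/-! ### Periodic digit sequences -/

section Digits

/-- The value of the `m` base-`q` digits of `d` from position `k` on. -/
def digitValue (q m : ℕ) (d : ℕ → ℕ) (k : ℕ) : ℕ := ∑ i ∈ Finset.range m, d (k + i) * q ^ i

variable {q m : ℕ} {d : ℕ → ℕ}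

theorem digitValue_succ (q m : ℕ) (d : ℕ → ℕ) (k : ℕ) :
    q * digitValue q m d (k + 1) + d k = digitValue q m d k + d (k + m) * q ^ m := by
  have h1 := Finset.sum_range_succ (fun i => d (k + i) * q ^ i) m
  have h2 := Finset.sum_range_succ' (fun i => d (k + i) * q ^ i) m
  rw [h1] at h2
  simp only [digitValue]
  rw [h2, Finset.mul_sum]
  simp only [add_zero, pow_zero, mul_one, Nat.add_right_cancel_iff]
  refine Finset.sum_congr rfl fun i _ => ?_
  rw [pow_succ, add_right_comm, add_assoc]
  ring

theorem digitValue_modEq (hq : 1 ≤ q) (hper : ∀ i, d (i + m) = d i) (k : ℕ) :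
    (digitValue q m d 0 : ℤ) ≡ digitValue q m d k * (q : ℤ) ^ k [ZMOD ((q ^ m - 1 : ℕ) : ℤ)] := by
  induction k with
  | zero => simp
  | succ k ih =>
    refine ih.trans ?_
    rw [pow_succ', ← mul_assoc]
    refine Int.ModEq.mul_right _ ?_
    refine (Int.modEq_iff_dvd).2 ⟨d k, ?_⟩
    have h : ((q * digitValue q m d (k + 1) + d k : ℕ) : ℤ) =
      (digitValue q m d k + d (k + m) * q ^ m : ℕ) := by rw [digitValue_succ]
    rw [hper] at h
    push_cast [Nat.one_le_pow m q hq] at h ⊢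
    linarith

theorem le_digitValue (k : ℕ) {w : ℕ} (hw : w ≤ m)
    (hd : ∀ k, ∃ i, k ≤ i ∧ i < k + w ∧ d i ≠ 0) (hq : 1 ≤ q) :
    q ^ (m - w) ≤ digitValue q m d k := by
  obtain ⟨i, h1, h2, h3⟩ := hd (k + (m - w))
  obtain ⟨j, rfl⟩ := Nat.exists_eq_add_of_le (show k ≤ i by lia)
  calc q ^ (m - w) ≤ q ^ j := Nat.pow_le_pow_right hq (by lia)
    _ ≤ d (k + j) * q ^ j := Nat.le_mul_of_pos_left _ (Nat.pos_of_ne_zero h3)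
    _ ≤ digitValue q m d k :=
      Finset.single_le_sum (f := fun i => d (k + i) * q ^ i) (fun _ _ => Nat.zero_le _)
        (Finset.mem_range.2 (by lia))

theorem digitValue_add_compl (hq : 1 ≤ q) (hd : ∀ i, d i ≤ q - 1) (k : ℕ) :
    digitValue q m d k + digitValue q m (fun i => q - 1 - d i) k + 1 = q ^ m := by
  rw [digitValue, digitValue, ← Finset.sum_add_distrib, ← repunit_mul q m hq, repunit,
    Finset.sum_mul]
  congr 1
  refine Finset.sum_congr rfl fun i _ => ?_
  rw [← add_mul, Nat.add_sub_cancel' (hd _), mul_comm]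

/-- The conjugates of `z` are the rotated digit values divided by `q ^ s - 1`. A nonzero digit among
the top `s * (r / 2)` bounds such a value below. For `-z` the same argument applies to the
complementary digits `q - 1 - d i`. -/
theorem exists_forall_le_conj {s r t : ℕ} (hq : 2 ≤ q) (hs : 0 < s) (hr : 2 ≤ r) (htr : t < r)
    (hper : ∀ i, d (i + s * r) = d i) (hd : ∀ i, d i ≤ q - 1)
    (hdvd : q ^ s - 1 ∣ ∑ i ∈ Finset.range (s * r), d i * q ^ i)
    (h0 : ∀ k, ∃ i, k ≤ i ∧ i < k + s * (r / 2) ∧ d i ≠ 0)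
    (h1 : ∀ k, ∃ i, k ≤ i ∧ i < k + s * t ∧ d i ≠ q - 1) :
    ∃ z : ℤ, ∀ k : ℕ,
      (repunit (q ^ s) (r - r / 2) : ℤ) ≤ (z * (q : ℤ) ^ k) % repunit (q ^ s) r ∧
      (repunit (q ^ s) (r - t) : ℤ) ≤ (-z * (q : ℤ) ^ k) % repunit (q ^ s) r := by
  have hq1 : 1 ≤ q := by lia
  have hQ : 1 ≤ q ^ s := Nat.one_le_pow _ _ hq1
  have hQ2 : 2 ≤ q ^ s := hq.trans (Nat.le_self_pow hs.ne' q)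
  have hm : 0 < s * r := by positivity
  set n := repunit (q ^ s) r with hn
  have hN : q ^ (s * r) - 1 = (q ^ s - 1) * n := by
    rw [pow_mul, ← repunit_mul (q ^ s) r hQ, Nat.add_sub_cancel, mul_comm]
  have hV0 : digitValue q (s * r) d 0 = ∑ i ∈ Finset.range (s * r), d i * q ^ i := by
    simp [digitValue]
  rw [← hV0] at hdvd
  obtain ⟨z, hz⟩ := hdvd
  refine ⟨z, fun k => ?_⟩
  -- Starting the digits at position `j` divides by `q ^ j`. This choice of `j` turns division into
  -- multiplication by `q ^ k`.
  set j := k * (s * r - 1) with hj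
  have hmod : (digitValue q (s * r) d 0 : ℤ) * (q : ℤ) ^ k ≡ digitValue q (s * r) d j
      [ZMOD ((q ^ (s * r) - 1 : ℕ) : ℤ)] := by
    have h2 := (digitValue_modEq hq1 hper j).mul_right ((q : ℤ) ^ k)
    refine h2.trans ?_
    have hqN : (q : ℤ) ^ (s * r) ≡ 1 [ZMOD ((q ^ (s * r) - 1 : ℕ) : ℤ)] := by
      refine Int.ModEq.symm ((Int.modEq_iff_dvd).2 ⟨1, ?_⟩)
      push_cast [Nat.one_le_pow (s * r) q hq1]
      ring
    have := pow_mul_sub_one_modEq hqN hm (digitValue q (s * r) d j : ℤ) k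
    rwa [mul_right_comm] at this
  have hVj : q ^ s - 1 ∣ digitValue q (s * r) d j := by
    have h2 := hmod.symm.dvd
    rw [hN, hz] at h2
    push_cast only [Nat.cast_mul] at h2
    have h3 : ((q ^ s - 1 : ℕ) : ℤ) ∣ digitValue q (s * r) d j := by
      have h4 := (Dvd.intro _ rfl : ((q ^ s - 1 : ℕ) : ℤ) ∣ ((q ^ s - 1 : ℕ) : ℤ) * n).trans h2
      rw [mul_assoc] at h4
      exact (dvd_sub_right (dvd_mul_right _ _)).1 h4
    exact_mod_cast h3
  obtain ⟨y, hy⟩ := hVj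
  have hzy : (z : ℤ) * (q : ℤ) ^ k ≡ y [ZMOD n] := by
    have h2 := hmod.symm.dvd
    rw [hN, hz, hy] at h2
    push_cast only [Nat.cast_mul] at h2
    rw [mul_assoc, ← mul_sub] at h2
    exact ((Int.modEq_iff_dvd).2
      (Int.dvd_of_mul_dvd_mul_left (by lia : ((q ^ s - 1 : ℕ) : ℤ) ≠ 0) h2)).symm
  have hlow := le_digitValue (q := q) (m := s * r) j (Nat.mul_le_mul_left s (Nat.div_le_self r 2))
    h0 hq1
  have hcompl := digitValue_add_compl (m := s * r) hq1 hd j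
  have hhigh := le_digitValue (q := q) (m := s * r) (d := fun i => q - 1 - d i) j
    (Nat.mul_le_mul_left s htr.le)
    (fun k => by
      obtain ⟨i, h2, h3, h4⟩ := h1 k
      have := hd i
      exact ⟨i, h2, h3, by lia⟩) hq1
  -- Powers of `Q = q ^ s` become `R_j * (Q - 1) + 1`, so that `Q - 1` can be cancelled.
  rw [← Nat.mul_sub, pow_mul, ← repunit_mul _ _ hQ] at hlow hhigh
  have hyl : repunit (q ^ s) (r - r / 2) ≤ y := by
    rw [hy, mul_comm (q ^ s - 1)] at hlow
    exact Nat.le_of_mul_le_mul_right (by lia) (show 0 < q ^ s - 1 by lia)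
  have hyh : repunit (q ^ s) (r - t) + y ≤ n := by
    have h2 : repunit (q ^ s) (r - t) * (q ^ s - 1) + y * (q ^ s - 1) ≤ n * (q ^ s - 1) := by
      rw [mul_comm n, ← hN, ← hcompl, hy, mul_comm y]
      lia
    rw [← add_mul] at h2
    exact Nat.le_of_mul_le_mul_right h2 (show 0 < q ^ s - 1 by lia)
  have hpos1 := repunit_strictMono hQ (show 0 < r - r / 2 by lia)
  have hpos2 := repunit_strictMono hQ (show 0 < r - t by lia)
  constructor
  · rw [hzy, Int.emod_eq_of_lt (by lia) (by lia)]
    exact_mod_cast hyl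
  · have h2 : -(z : ℤ) * (q : ℤ) ^ k ≡ n - y [ZMOD n] := by
      have h3 := hzy.neg
      rw [← neg_mul] at h3
      refine h3.trans ((Int.modEq_iff_dvd).2 ⟨1, by ring⟩)
    rw [h2, Int.emod_eq_of_lt (by lia) (by lia)]
    lia

end Digits

/-! ### Explicit digit patterns -/

theorem exists_mem_window {P : ℕ → Prop} {w j : ℕ} (hj : j < w) (hPj : P j)
    (hstep : ∀ i, P i → ∃ i', i < i' ∧ i' ≤ i + w ∧ P i') (k : ℕ) :
    ∃ i, k ≤ i ∧ i < k + w ∧ P i := by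
  induction k with
  | zero => exact ⟨j, Nat.zero_le _, by lia, hPj⟩
  | succ k ih =>
    obtain ⟨i, h1, h2, h3⟩ := ih
    rcases h1.eq_or_lt with rfl | h1
    · obtain ⟨i', h4, h5, h6⟩ := hstep _ h3
      exact ⟨i', h4, by lia, h6⟩
    · exact ⟨i, h1, by lia, h3⟩

/-- Casting out: `q ^ s ≡ 1` modulo `q ^ s - 1`, so only the sum of the blocks of `s` digits
matters. -/
theorem dvd_sum_digits {q s r : ℕ} (hq : 1 ≤ q) (d : ℕ → ℕ)
    (h : q ^ s - 1 ∣ ∑ a ∈ Finset.range r, ∑ b ∈ Finset.range s, d (s * a + b) * q ^ b) :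
    q ^ s - 1 ∣ ∑ i ∈ Finset.range (s * r), d i * q ^ i := by
  have hQ : 1 ≤ q ^ s := Nat.one_le_pow _ _ hq
  have key (r : ℕ) : ∑ i ∈ Finset.range (s * r), d i * q ^ i ≡
      ∑ a ∈ Finset.range r, ∑ b ∈ Finset.range s, d (s * a + b) * q ^ b [MOD q ^ s - 1] := by
    induction r with
    | zero => simpa using Nat.ModEq.refl _
    | succ r ih =>
      rw [Nat.mul_succ, Finset.sum_range_add, Finset.sum_range_succ]
      refine ih.add ?_
      have h1 : ∑ b ∈ Finset.range s, d (s * r + b) * q ^ (s * r + b) =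
          (q ^ s) ^ r * ∑ b ∈ Finset.range s, d (s * r + b) * q ^ b := by
        rw [Finset.mul_sum]
        refine Finset.sum_congr rfl fun b _ => ?_
        rw [pow_add, pow_mul]; ring
      have h2 : q ^ s ≡ 1 [MOD q ^ s - 1] := ((Nat.modEq_iff_dvd' hQ).2 dvd_rfl).symm
      rw [h1]
      simpa using (h2.pow r).mul_right _
  exact ((key r).dvd_iff dvd_rfl).2 h

/-- The digit sequence of period `s * r` whose `a`-th block of `s` digits is `g a`. -/
def blockDigits (g : ℕ → ℕ → ℕ) (s r i : ℕ) : ℕ := g (i / s % r) (i % s)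

theorem blockDigits_add_mul {g : ℕ → ℕ → ℕ} {s r : ℕ} (hs : 0 < s) (i : ℕ) :
    blockDigits g s r (i + s * r) = blockDigits g s r i := by
  simp [blockDigits, Nat.add_mul_div_left _ _ hs]

theorem blockDigits_apply {g : ℕ → ℕ → ℕ} {s r a b c : ℕ} (hb : b < s) (ha : a < r) :
    blockDigits g s r (s * (r * c + a) + b) = g a b := by
  have h1 : (s * (r * c + a) + b) / s = r * c + a := by
    rw [Nat.mul_add_div (by lia), Nat.div_eq_of_lt hb, add_zero]
  rw [blockDigits, h1, Nat.mul_add_mod, Nat.mul_add_mod, Nat.mod_eq_of_lt hb, Nat.mod_eq_of_lt ha]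

theorem dvd_sum_blockDigits {q s r : ℕ} (hq : 1 ≤ q) (g : ℕ → ℕ → ℕ)
    (h : q ^ s - 1 ∣ ∑ b ∈ Finset.range s, (∑ a ∈ Finset.range r, g a b) * q ^ b) :
    q ^ s - 1 ∣ ∑ i ∈ Finset.range (s * r), blockDigits g s r i * q ^ i := by
  refine dvd_sum_digits hq _ ?_
  convert h using 1
  rw [Finset.sum_comm]
  refine Finset.sum_congr rfl fun b hb => ?_
  rw [Finset.sum_mul]
  refine Finset.sum_congr rfl fun a ha => ?_
  rw [Finset.mem_range] at ha hb
  have := blockDigits_apply (g := g) (c := 0) hb ha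
  rw [mul_zero, zero_add] at this
  rw [this]

/-- The blocks `u₀`, `u₁`, `u₂` in places `0`, `1` and `f + 1`, and zero elsewhere. -/
def threeBlocks (f : ℕ) (u₀ u₁ u₂ : ℕ → ℕ) (a b : ℕ) : ℕ :=
  (if a = 0 then u₀ b else 0) + (if a = 1 then u₁ b else 0) + if a = f + 1 then u₂ b else 0

theorem sum_threeBlocks {f r : ℕ} (hfr : f + 1 < r) (u₀ u₁ u₂ : ℕ → ℕ) (b : ℕ) :
    ∑ a ∈ Finset.range r, threeBlocks f u₀ u₁ u₂ a b = u₀ b + u₁ b + u₂ b := by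
  have h0 : 0 < r := by lia
  have h1 : 1 < r := by lia
  simp [threeBlocks, Finset.sum_add_distrib, hfr, h0, h1]

theorem threeBlocks_le {f c : ℕ} (hf : 0 < f) {u₀ u₁ u₂ : ℕ → ℕ} {b : ℕ} (h0 : u₀ b ≤ c)
    (h1 : u₁ b ≤ c) (h2 : u₂ b ≤ c) (a : ℕ) : threeBlocks f u₀ u₁ u₂ a b ≤ c := by
  unfold threeBlocks
  split_ifs <;> lia

/-- The conclusion of the digit constructions: `z` and `-z` have only large conjugates. -/
def HasLargeConj (q s r t : ℕ) (z : ℤ) : Prop :=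
  ∀ k : ℕ, (repunit (q ^ s) (r - r / 2) : ℤ) ≤ (z * (q : ℤ) ^ k) % repunit (q ^ s) r ∧
    (repunit (q ^ s) (r - t) : ℤ) ≤ (-z * (q : ℤ) ^ k) % repunit (q ^ s) r

/-- Ones sit at `0`, `2` and `r / 2 + 1`. Cyclic gaps are at most `r / 2`, and `r ≥ 6` keeps the
ones nonadjacent. Windows of length one cannot avoid the digit `q - 1 = 1`, whence `t = 2`;
divisibility by `2 ^ 1 - 1` is vacuous. -/
theorem exists_hasLargeConj_two_one {r : ℕ} (hr : 6 ≤ r) : ∃ z, HasLargeConj 2 1 r 2 z := by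
  set f := r / 2 with hf
  let g : ℕ → ℕ → ℕ := fun a _ => if a = 0 ∨ a = 2 ∨ a = f + 1 then 1 else 0
  have hg {a : ℕ} (ha : a < r) (c : ℕ) :
      blockDigits g 1 r (r * c + a) = if a = 0 ∨ a = 2 ∨ a = f + 1 then 1 else 0 := by
    have := blockDigits_apply (g := g) (c := c) one_pos ha
    rwa [one_mul, add_zero] at this
  refine exists_forall_le_conj (d := blockDigits g 1 r) le_rfl one_pos (by lia) (by lia)
    (blockDigits_add_mul one_pos) (fun i => ?_) (by simp) ?_ fun k => ?_
  · simp only [blockDigits, g]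
    split_ifs <;> simp
  · refine exists_mem_window (j := 0) (by lia) ?_ fun i hi => ?_
    · have := hg (a := 0) (by lia) 0
      simp at this
      simp [this]
    · have hdm : r * (i / r) + i % r = i := Nat.div_add_mod i r
      set c := i / r
      rw [← hdm, hg (Nat.mod_lt _ (by lia))] at hi
      have hi' : i % r = 0 ∨ i % r = 2 ∨ i % r = f + 1 := by
        by_contra h
        simp [h] at hi
      rcases hi' with h | h | h
      · refine ⟨r * c + 2, by lia, by lia, ?_⟩
        rw [hg (by lia)]; simp
      · refine ⟨r * c + (f + 1), by lia, by lia, ?_⟩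
        rw [hg (by lia)]; simp
      · refine ⟨r * (c + 1) + 0, by rw [mul_add]; lia, by rw [mul_add]; lia, ?_⟩
        rw [hg (by lia)]; simp
  · have hdm : r * (k / r) + k % r = k := Nat.div_add_mod k r
    have hlt : k % r < r := Nat.mod_lt _ (by lia)
    by_cases h : k % r = 0 ∨ k % r = 2 ∨ k % r = f + 1
    · refine ⟨r * (k / r) + (k % r + 1), by lia, by lia, ?_⟩
      rw [hg (by lia), if_neg (by lia)]
      decide
    · refine ⟨k, le_rfl, by lia, ?_⟩
      rw [← hdm, hg hlt, if_neg h]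
      decide

/-- All digits are `1` except one digit `c` per period, which corrects the digit sum modulo `q - 1`.
Even if `c = 0`, windows of length `r / 2 ≥ 2` contain a `1`. -/
theorem exists_hasLargeConj_one {q r : ℕ} (hq : 3 ≤ q) (hr : 4 ≤ r) :
    ∃ z, HasLargeConj q 1 r 1 z := by
  obtain ⟨c, hc, hcd⟩ : ∃ c, c < q - 1 ∧ q - 1 ∣ c + (r - 1) := by
    refine ⟨(q - 1 - (r - 1) % (q - 1)) % (q - 1), Nat.mod_lt _ (by lia), ?_⟩
    have h1 : (r - 1) % (q - 1) < q - 1 := Nat.mod_lt _ (by lia)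
    rw [Nat.dvd_iff_mod_eq_zero, Nat.add_mod, Nat.mod_mod, ← Nat.add_mod, Nat.add_mod_eq_add_mod_left
      _ (Nat.mod_mod (r - 1) (q - 1)).symm, Nat.sub_add_cancel h1.le, Nat.mod_self]
  let g : ℕ → ℕ → ℕ := fun a _ => if a = 0 then c else 1
  have hle (i : ℕ) : blockDigits g 1 r i < q - 1 := by
    simp only [blockDigits, g]
    split_ifs <;> lia
  have hg {a : ℕ} (ha : a < r) (ha0 : a ≠ 0) (c : ℕ) : blockDigits g 1 r (r * c + a) = 1 := by
    have := blockDigits_apply (g := g) (c := c) one_pos ha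
    rw [one_mul, add_zero] at this
    rw [this]
    exact if_neg ha0
  refine exists_forall_le_conj (d := blockDigits g 1 r) (by lia) one_pos (by lia) (by lia)
    (blockDigits_add_mul one_pos) (fun i => (hle i).le) ?_ (fun k => ?_) fun k => ?_
  · refine dvd_sum_blockDigits (by lia) g ?_
    obtain ⟨p, rfl⟩ : ∃ p, r = p + 1 := ⟨r - 1, by lia⟩
    simp only [g, Finset.range_one, Finset.sum_singleton, Finset.sum_range_succ']
    simpa [add_comm] using hcd
  · have hdm : r * (k / r) + k % r = k := Nat.div_add_mod k r
    have hlt : k % r < r := Nat.mod_lt _ (by lia)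
    by_cases h : k % r = 0
    · refine ⟨r * (k / r) + 1, by lia, by lia, ?_⟩
      rw [hg (by lia) one_ne_zero]
      exact one_ne_zero
    · refine ⟨k, le_rfl, by lia, ?_⟩
      rw [← hdm, hg hlt h]
      exact one_ne_zero
  · exact ⟨k, le_rfl, by lia, (hle k).ne⟩

/-- With `s = p + 2`, the blocks `2 ^ p`, `2 ^ p` and `2 ^ (p + 1) - 1` add up to `2 ^ s - 1`. Each
has digit `p` equal to `1`, and every block has top digit `0`, which serves all windows of length
`s`. -/
theorem exists_hasLargeConj_two {s r : ℕ} (hs : 2 ≤ s) (hr : 3 ≤ r) :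
    ∃ z, HasLargeConj 2 s r 1 z := by
  obtain ⟨p, rfl⟩ := Nat.exists_eq_add_of_le' hs
  set f := r / 2 with hf
  let u : ℕ → ℕ := fun b => if b = p then 1 else 0
  let w : ℕ → ℕ := fun b => if b = p + 1 then 0 else 1
  let g := threeBlocks f u u w
  have hle (i : ℕ) : blockDigits g (p + 2) r i ≤ 1 := by
    refine threeBlocks_le (by lia) ?_ ?_ ?_ _ <;> simp only [u, w] <;> split_ifs <;> simp
  have hg {a : ℕ} (ha : a < r) (ha' : a = 0 ∨ a = 1 ∨ a = f + 1) (c : ℕ) :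
      blockDigits g (p + 2) r ((p + 2) * (r * c + a) + p) ≠ 0 := by
    rw [blockDigits_apply (by lia) ha]
    rcases ha' with rfl | rfl | rfl <;> simp [g, threeBlocks, u, w]
  refine exists_forall_le_conj (d := blockDigits g (p + 2) r) le_rfl (by lia) (by lia) (by lia)
    (blockDigits_add_mul (by lia)) hle ?_ ?_ fun k => ?_
  · refine dvd_sum_blockDigits (by lia) g ?_
    have h1 := repunit_mul 2 (p + 1) one_le_two
    have h2 : ∑ b ∈ Finset.range (p + 2), (u b + u b + w b) * 2 ^ b = 2 ^ (p + 2) - 1 := by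
      have hw : ∑ b ∈ Finset.range (p + 2), w b * 2 ^ b = repunit 2 (p + 1) := by
        rw [Finset.sum_range_succ, repunit]
        simp only [w, if_true, zero_mul, add_zero]
        refine Finset.sum_congr rfl fun b hb => ?_
        rw [Finset.mem_range] at hb
        rw [if_neg (by lia), one_mul]
      have hu : ∑ b ∈ Finset.range (p + 2), u b * 2 ^ b = 2 ^ p := by
        simp [u]
      simp only [add_mul, Finset.sum_add_distrib, hw, hu]
      rw [pow_succ] at h1 ⊢
      rw [pow_succ]
      lia
    simp only [g, sum_threeBlocks (show f + 1 < r by lia), h2, dvd_refl]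
  · intro k
    have hsf : (p + 2) * 1 ≤ (p + 2) * f := Nat.mul_le_mul_left _ (by lia)
    have hlast : (p + 2) * (r - 1 - f) ≤ (p + 2) * f := Nat.mul_le_mul_left _ (by lia)
    have hlast' : (p + 2) * (r - 1 - f) + (p + 2) * (f + 1) = (p + 2) * r := by
      rw [← mul_add]; congr 1; lia
    have hpos : 0 < (p + 2) * (r - 1 - f) := Nat.mul_pos (by lia) (by lia)
    obtain ⟨i, h1, h2, c, a, ha, hi⟩ := exists_mem_window (w := (p + 2) * f) (j := p)
      (P := fun i => ∃ c a, (a = 0 ∨ a = 1 ∨ a = f + 1) ∧ i = (p + 2) * (r * c + a) + p)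
      (by lia) ⟨0, 0, by simp⟩ (by
        rintro i ⟨c, a, rfl | rfl | rfl, rfl⟩
        · refine ⟨_, ?_, ?_, c, 1, by simp, rfl⟩ <;> simp only [mul_add] <;> lia
        · refine ⟨_, ?_, ?_, c, f + 1, by simp, rfl⟩ <;> simp only [mul_add] <;> lia
        · refine ⟨_, ?_, ?_, c + 1, 0, by simp, rfl⟩ <;> simp only [mul_add] at * <;> lia) k
    exact ⟨i, h1, h2, hi ▸ hg (by lia) ha c⟩
  · refine ⟨(p + 2) * (k / (p + 2)) + (p + 1), ?_, ?_, ?_⟩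
    · have := Nat.div_add_mod k (p + 2)
      have := Nat.mod_lt k (show 0 < p + 2 by lia)
      lia
    · have := Nat.div_add_mod k (p + 2)
      lia
    · have h1 : ((p + 2) * (k / (p + 2)) + (p + 1)) % (p + 2) = p + 1 := by
        rw [Nat.mul_add_mod, Nat.mod_eq_of_lt (by lia)]
      simp [blockDigits, h1, g, threeBlocks, u, w]

/-- The three blocks add digitwise to `q - 1` without carries, and every digit is at most `q - 2`.
Placing the block of ones at `1` and the others at `0` and `r / 2 + 1` keeps the runs of zeros
short. -/
theorem exists_hasLargeConj {q s r : ℕ} (hq : 3 ≤ q) (hs : 2 ≤ s) (hr : 3 ≤ r) :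
    ∃ z, HasLargeConj q s r 1 z := by
  obtain ⟨p, rfl⟩ := Nat.exists_eq_add_of_le' hs
  set f := r / 2 with hf
  let u : ℕ → ℕ := fun b => if b = p + 1 then 0 else q - 2
  let w : ℕ → ℕ := fun b => if b = p + 1 then q - 2 else 0
  let g := threeBlocks f u (fun _ => 1) w
  have hle (i : ℕ) : blockDigits g (p + 2) r i ≤ q - 2 := by
    refine threeBlocks_le (f := f) (u₀ := u) (u₁ := fun _ => 1) (u₂ := w) (b := i % (p + 2))
      (by lia) ?_ (by lia) ?_ _ <;> simp only [u, w] <;> split_ifs <;> lia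
  have hg {a b : ℕ} (ha : a < r)
      (hab : a = 0 ∧ b = 0 ∨ a = 1 ∧ b = 0 ∨ a = 1 ∧ b = p + 1 ∨ a = f + 1 ∧ b = p + 1) (c : ℕ) :
      blockDigits g (p + 2) r ((p + 2) * (r * c + a) + b) ≠ 0 := by
    rw [blockDigits_apply (by lia) ha]
    have : q - 2 ≠ 0 := by lia
    rcases hab with ⟨rfl, rfl⟩ | ⟨rfl, rfl⟩ | ⟨rfl, rfl⟩ | ⟨rfl, rfl⟩ <;>
      simp [g, threeBlocks, u, w, this]
  refine exists_forall_le_conj (d := blockDigits g (p + 2) r) (by lia) (by lia) (by lia) (by lia)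
    (blockDigits_add_mul (by lia)) (fun i => (hle i).trans (by lia)) ?_ (fun k => ?_) fun k => ?_
  · refine dvd_sum_blockDigits (by lia) g ?_
    have h1 := repunit_mul q (p + 2) (by lia)
    have h2 (b : ℕ) : u b + 1 + w b = q - 1 := by
      simp only [u, w]
      split_ifs <;> lia
    simp only [g, sum_threeBlocks (show f + 1 < r by lia), h2, ← Finset.mul_sum]
    rw [← h1, Nat.add_sub_cancel, mul_comm]
    exact dvd_rfl
  · have hsf : (p + 2) * (r - 2 - f) + (p + 2) * 1 ≤ (p + 2) * f := by
      rw [← mul_add]; exact Nat.mul_le_mul_left _ (by lia)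
    have hlast' : (p + 2) * (r - 2 - f) + (p + 2) * (f + 2) = (p + 2) * r := by
      rw [← mul_add]; congr 1; lia
    obtain ⟨i, h1, h2, c, a, b, hab, hi⟩ := exists_mem_window (w := (p + 2) * f) (j := 0)
      (P := fun i => ∃ c a b, (a = 0 ∧ b = 0 ∨ a = 1 ∧ b = 0 ∨ a = 1 ∧ b = p + 1 ∨
        a = f + 1 ∧ b = p + 1) ∧ i = (p + 2) * (r * c + a) + b)
      (by lia) ⟨0, 0, 0, by simp⟩ (by
        rintro i ⟨c, a, b, ⟨rfl, rfl⟩ | ⟨rfl, rfl⟩ | ⟨rfl, rfl⟩ | ⟨rfl, rfl⟩, rfl⟩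
        · refine ⟨_, ?_, ?_, c, 1, 0, by simp, rfl⟩ <;> simp only [mul_add] <;> lia
        · refine ⟨_, ?_, ?_, c, 1, p + 1, by simp, rfl⟩ <;> simp only [mul_add] <;> lia
        · refine ⟨_, ?_, ?_, c, f + 1, p + 1, by simp, rfl⟩ <;> simp only [mul_add] <;> lia
        · refine ⟨_, ?_, ?_, c + 1, 0, 0, by simp, rfl⟩ <;> simp only [mul_add] at * <;> lia) k
    exact ⟨i, h1, h2, hi ▸ hg (by lia) hab c⟩
  · exact ⟨k, le_rfl, by lia, by have := hle k; lia⟩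

/-! ### Coset leaders -/

section Leaders

variable {q n m : ℕ}

theorem IsCosetLeader.le_of_hasConjLE {a t : ℕ} (ha : IsCosetLeader q n a)
    (h : HasConjLE q n a t) : a ≤ t := by
  obtain ⟨k, hk⟩ := h
  have h1 : a ≤ (a * q ^ k) % n := ha.2.2 ⟨k, rfl⟩
  have h2 : (((a * q ^ k) % n : ℕ) : ℤ) ≤ t := by push_cast; exact hk
  lia

theorem exists_isCosetLeader (hn : 0 < n) (a : ℤ) :
    ∃ l : ℕ, IsCosetLeader q n l ∧ ∃ k : ℕ, (a * (q : ℤ) ^ k) % n = l := by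
  classical
  have hn' : (0 : ℤ) < n := by exact_mod_cast hn
  have hex : ∃ l : ℕ, ∃ k : ℕ, (a * (q : ℤ) ^ k) % n = l :=
    ⟨(a % n).toNat, 0, by
      rw [pow_zero, mul_one, Int.toNat_of_nonneg (Int.emod_nonneg _ hn'.ne')]⟩
  obtain ⟨k, hk⟩ := Nat.find_spec hex
  have hlt : Nat.find hex < n := by
    have := Int.emod_lt_of_pos (a * (q : ℤ) ^ k) hn'
    lia
  refine ⟨Nat.find hex, ⟨hlt, ⟨0, by rw [pow_zero, mul_one, Nat.mod_eq_of_lt hlt]⟩, ?_⟩, k, hk⟩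
  rintro x ⟨j, rfl⟩
  refine Nat.find_min' hex ⟨k + j, ?_⟩
  rw [pow_add, ← mul_assoc]
  push_cast
  rw [← hk]
  exact ((Int.mod_modEq _ _).mul_right _).symm

theorem pos_of_hasConjLE (hqn : (q : ℤ) ^ m ≡ 1 [ZMOD n]) (hm : 0 < m) (hn : 0 < n) {a : ℤ}
    (ha : ¬ (n : ℤ) ∣ a) {t : ℕ} (h : HasConjLE q n a t) : 0 < t := by
  obtain ⟨k, hk⟩ := h
  rw [Nat.pos_iff_ne_zero]
  rintro rfl
  have := Int.emod_nonneg (a * (q : ℤ) ^ k) (show (n : ℤ) ≠ 0 by lia)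
  exact not_dvd_mul_pow hqn hm ha k (Int.dvd_of_emod_eq_zero (by lia))

/-- Beyond the largest coset leader the dual code has the single zero `1`. -/
theorem exchange_of_lt (hqn : (q : ℤ) ^ m ≡ 1 [ZMOD n]) (hm : 0 < m) (hn : 0 < n) {δ₁ D : ℕ}
    (hδ₁ : δ₁ ∈ upperBounds {a | IsCosetLeader q n a}) (hD : δ₁ ≤ D) {a : ℤ}
    (ha : ¬ (n : ℤ) ∣ a) : HasConjLE q n a 0 ↔ ¬ HasConjLE q n (-a) D := by
  refine iff_of_false (fun h => (pos_of_hasConjLE hqn hm hn ha h).ne rfl) (not_not_intro ?_)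
  obtain ⟨l, hl, k, hk⟩ := exists_isCosetLeader (q := q) hn (-a)
  refine ⟨k, ?_⟩
  rw [hk]
  exact_mod_cast (hδ₁ hl).trans hD

end Leaders

/-! ### The two largest binary coset leaders -/

section Binary

variable {m n : ℕ}

theorem two_pow_modEq_one (hn : n = 2 ^ m - 1) : ((2 : ℕ) : ℤ) ^ m ≡ 1 [ZMOD n] := by
  refine ((Int.modEq_iff_dvd).2 ⟨1, ?_⟩).symm
  rw [hn]
  push_cast [Nat.one_le_two_pow (n := m)]
  ring

/-- Complementing bits reverses order: `n - c` is least in its coset when `c` is largest in its own.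
-/
theorem isCosetLeader_compl (hm : 0 < m) (hn : n = 2 ^ m - 1) {c : ℕ} (hc0 : 0 < c) (hcn : c < n)
    (h : ∀ k < m, ∃ y : ℕ, 0 < y ∧ y ≤ c ∧ c * 2 ^ k ≡ y [MOD n]) :
    IsCosetLeader 2 n (n - c) := by
  refine ⟨by lia, ⟨0, by rw [pow_zero, mul_one, Nat.mod_eq_of_lt (by lia)]⟩, ?_⟩
  rintro x ⟨k, rfl⟩
  obtain ⟨y, hy0, hyc, hy⟩ := h (k % m) (Nat.mod_lt k hm)
  have h2 : 2 ^ m ≡ 1 [MOD n] := by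
    rw [hn]
    exact ((Nat.modEq_iff_dvd' Nat.one_le_two_pow).2 dvd_rfl).symm
  have h3 : 2 ^ k ≡ 2 ^ (k % m) [MOD n] := by
    conv_lhs => rw [← Nat.div_add_mod k m, pow_add, pow_mul]
    simpa using (h2.pow (k / m)).mul_right (2 ^ (k % m))
  have h4 : (n - c) * 2 ^ k ≡ n - y [MOD n] := by
    refine Nat.ModEq.add_right_cancel ((h3.mul_left c).trans hy) ?_
    rw [← add_mul, Nat.sub_add_cancel hcn.le, Nat.sub_add_cancel (by lia)]
    exact (Nat.modEq_zero_iff_dvd.2 (dvd_mul_right _ _)).trans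
      (Nat.modEq_zero_iff_dvd.2 dvd_rfl).symm
  rw [h4, Nat.mod_eq_of_lt (by lia)]
  lia

theorem two_pow_add_modEq (hn : n = 2 ^ m - 1) (j : ℕ) : 2 ^ (m + j) ≡ 2 ^ j [MOD n] := by
  have h2 : 2 ^ m ≡ 1 [MOD n] := by
    rw [hn]
    exact ((Nat.modEq_iff_dvd' Nat.one_le_two_pow).2 dvd_rfl).symm
  rw [pow_add]
  simpa using h2.mul_right (2 ^ j)

theorem isCosetLeader_two_pow_sub_one (hm : 2 ≤ m) (hn : n = 2 ^ m - 1) :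
    IsCosetLeader 2 n (2 ^ (m - 1) - 1) := by
  obtain ⟨p, rfl⟩ := Nat.exists_eq_add_of_le' (show 1 ≤ m by lia)
  have hp : 2 ≤ 2 ^ p := Nat.le_self_pow (by lia) 2
  have h1 : 2 ^ (p + 1) = 2 * 2 ^ p := pow_succ' 2 p
  have h := isCosetLeader_compl (c := 2 ^ p) (by lia) hn (by lia) (by lia) ?_
  · convert h using 1
    rw [Nat.add_sub_cancel]
    lia
  · intro k hk
    rcases Nat.eq_zero_or_pos k with rfl | hk0
    · exact ⟨2 ^ p, by lia, le_rfl, by simpa using Nat.ModEq.refl _⟩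
    · refine ⟨2 ^ (k - 1), by positivity, Nat.pow_le_pow_right (by lia) (by lia), ?_⟩
      rw [← pow_add, show p + k = p + 1 + (k - 1) by lia]
      exact two_pow_add_modEq hn _

/-- The complement has two ones, at `p = m - 1` and `p / 2`. They split the cycle as evenly as
possible, and no rotation brings the second closer below a leading one. -/
theorem isCosetLeader_second (hm : 4 ≤ m) (hn : n = 2 ^ m - 1) :
    IsCosetLeader 2 n (2 ^ (m - 1) - 2 ^ ((m - 1) / 2) - 1) := by
  obtain ⟨p, rfl⟩ := Nat.exists_eq_add_of_le' (show 1 ≤ m by lia)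
  rw [Nat.add_sub_cancel]
  set e := p / 2 with he
  have he1 : 2 * 2 ^ e ≤ 2 ^ p := by
    rw [← pow_succ']
    exact Nat.pow_le_pow_right (by lia) (by lia)
  have he2 : 2 ≤ 2 ^ e := Nat.le_self_pow (by lia) 2
  have h1 : 2 ^ (p + 1) = 2 * 2 ^ p := pow_succ' 2 p
  have h := isCosetLeader_compl (c := 2 ^ p + 2 ^ e) (by lia) hn (by lia) (by lia) ?_
  · convert h using 1
    lia
  · intro k hk
    rcases Nat.eq_zero_or_pos k with rfl | hk0
    · exact ⟨2 ^ p + 2 ^ e, by lia, le_rfl, by simpa using Nat.ModEq.refl _⟩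
    have hpk : 2 ^ (p + k) ≡ 2 ^ (k - 1) [MOD n] := by
      rw [show p + k = p + 1 + (k - 1) by lia]
      exact two_pow_add_modEq hn _
    have hmono {i j : ℕ} (hij : i ≤ j) : 2 ^ i ≤ 2 ^ j := Nat.pow_le_pow_right two_pos hij
    rcases lt_or_ge p (e + k) with hek | hek
    · refine ⟨2 ^ (k - 1) + 2 ^ (e + k - (p + 1)), by positivity, ?_, ?_⟩
      · have h2 : 2 ^ (e + k - (p + 1)) ≤ 2 ^ e := hmono (by lia)
        have h3 : 2 ^ (k - 1) ≤ 2 ^ p := hmono (by lia)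
        lia
      · rw [add_mul, ← pow_add, ← pow_add]
        refine hpk.add ?_
        conv_lhs => rw [show e + k = p + 1 + (e + k - (p + 1)) by lia]
        exact two_pow_add_modEq hn _
    · refine ⟨2 ^ (k - 1) + 2 ^ (e + k), by positivity, ?_, ?_⟩
      · rcases hek.eq_or_lt with hek | hek
        · have h2 : 2 ^ (k - 1) ≤ 2 ^ e := hmono (by lia)
          rw [hek]
          lia
        · have h2 : 2 ^ (k - 1) ≤ 2 ^ (p - 1) := hmono (by lia)
          have h3 : 2 ^ (e + k) ≤ 2 ^ (p - 1) := hmono (by lia)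
          have h4 : 2 ^ p = 2 * 2 ^ (p - 1) := by rw [← pow_succ']; congr 1; lia
          lia
      · rw [add_mul, ← pow_add, ← pow_add]
        exact hpk.add (Nat.ModEq.refl _)

theorem IsCosetLeader.le_two_pow_sub_one (hm : 2 ≤ m) (hn : n = 2 ^ m - 1) {a : ℕ}
    (ha : IsCosetLeader 2 n a) : a ≤ 2 ^ (m - 1) - 1 := by
  by_contra! h
  have h1 : 2 ^ m = 2 * 2 ^ (m - 1) := by rw [← pow_succ']; congr 1; lia
  have h2 : a ≤ (a * 2 ^ 1) % n := ha.2.2 ⟨1, rfl⟩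
  have h3 := ha.1
  rw [pow_one, Nat.mod_eq_sub_mod (by lia), Nat.mod_eq_of_lt (by lia)] at h2
  lia

theorem IsCosetLeader.le_second (hm : 4 ≤ m) (hn : n = 2 ^ m - 1) {a : ℕ}
    (ha : IsCosetLeader 2 n a) (hne : a ≠ 2 ^ (m - 1) - 1) :
    a ≤ 2 ^ (m - 1) - 2 ^ ((m - 1) / 2) - 1 := by
  have hle := ha.le_two_pow_sub_one (by lia) hn
  by_contra! h
  obtain ⟨p, rfl⟩ := Nat.exists_eq_add_of_le' (show 1 ≤ m by lia)
  rw [Nat.add_sub_cancel] at h hle hne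
  set e := p / 2 with he
  have he1 : 2 * 2 ^ e ≤ 2 ^ p := by
    rw [← pow_succ']
    exact Nat.pow_le_pow_right (by lia) (by lia)
  have h1 : 2 ^ (p + 1) = 2 * 2 ^ p := pow_succ' 2 p
  -- The complement of `a` is `2 ^ p + u` with `0 < u < 2 ^ e`. Rotating the top bit of `u` to
  -- position `p` moves the old top bit to position `i ≥ e`, giving a larger complement, hence a
  -- conjugate smaller than `a`.
  obtain ⟨u, hu⟩ : ∃ u, n = a + 2 ^ p + u := ⟨n - a - 2 ^ p, by lia⟩
  have hu0 : u ≠ 0 := by lia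
  have hue : u < 2 ^ e := by lia
  have hlow := Nat.pow_log_le_self 2 hu0
  have hhigh := Nat.lt_pow_succ_log_self (b := 2) (by lia) u
  set j := Nat.log 2 u with hj
  have hje : j < e := (Nat.pow_lt_pow_iff_right (a := 2) (by lia)).1 (hlow.trans_lt hue)
  obtain ⟨i, hi⟩ : ∃ i, p = j + (i + 1) := ⟨p - j - 1, by lia⟩
  have hup : 2 ^ p ≤ u * 2 ^ (i + 1) := by
    rw [hi, pow_add]
    exact Nat.mul_le_mul_right _ hlow
  have hup2 : u * 2 ^ (i + 1) + 2 ^ (i + 1) ≤ 2 ^ (p + 1) := by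
    rw [← Nat.succ_mul, hi, show j + (i + 1) + 1 = j + 1 + (i + 1) by lia, pow_add _ (j + 1)]
    exact Nat.mul_le_mul_right _ hhigh
  have hie : 2 ^ e ≤ 2 ^ i := Nat.pow_le_pow_right two_pos (by lia)
  have hi2 : 2 ^ (i + 1) = 2 * 2 ^ i := pow_succ' 2 i
  have hiu : 2 ≤ 2 ^ i := by
    have : 2 ≤ 2 ^ e := Nat.le_self_pow (by lia) 2
    lia
  set y := 2 ^ i + u * 2 ^ (i + 1) with hy
  have hmod : a * 2 ^ (i + 1) ≡ n - y [MOD n] := by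
    have h5 : (2 ^ p + u) * 2 ^ (i + 1) ≡ y [MOD n] := by
      rw [add_mul, ← pow_add, show p + (i + 1) = p + 1 + i by lia]
      exact (two_pow_add_modEq hn i).add_right _
    refine Nat.ModEq.add_right_cancel h5 ?_
    rw [← add_mul, ← add_assoc, ← hu, Nat.sub_add_cancel (by lia)]
    exact (Nat.modEq_zero_iff_dvd.2 (dvd_mul_right _ _)).trans
      (Nat.modEq_zero_iff_dvd.2 dvd_rfl).symm
  have h6 : a ≤ (a * 2 ^ (i + 1)) % n := ha.2.2 ⟨i + 1, rfl⟩
  rw [hmod, Nat.mod_eq_of_lt (by lia)] at h6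
  lia

theorem hasConjLE_two_iff (hm : 2 ≤ m) (hn : n = 2 ^ m - 1) (a : ℤ) :
    HasConjLE 2 n a 2 ↔ HasConjLE 2 n a 1 := by
  refine ⟨?_, fun h => h.mono one_le_two⟩
  rintro ⟨k, hk⟩
  by_cases h : (a * ((2 : ℕ) : ℤ) ^ k) % n = 2
  · refine ⟨k + (m - 1), ?_⟩
    have h1 : a * ((2 : ℕ) : ℤ) ^ k ≡ 2 [ZMOD n] := by
      have := Int.mod_modEq (a * ((2 : ℕ) : ℤ) ^ k) n
      rw [h] at this
      exact this.symm
    have h2 := h1.mul_right (((2 : ℕ) : ℤ) ^ (m - 1))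
    rw [mul_assoc, ← pow_add] at h2
    have h3 : (2 : ℤ) * ((2 : ℕ) : ℤ) ^ (m - 1) = ((2 : ℕ) : ℤ) ^ m := by
      rw [Nat.cast_ofNat, ← pow_succ']; congr 1; lia
    rw [h3] at h2
    rw [h2.trans (two_pow_modEq_one hn)]
    exact emod_le_self_of_nonneg n zero_le_one
  · exact ⟨k, by lia⟩

/-- The largest leader `d = 2 ^ (m - 1) - 1` satisfies `2 * d ≡ -1`, so negation swaps the coset of
`1` with that of `d`. -/
theorem hasConjLE_one_iff (hm : 4 ≤ m) (hn : n = 2 ^ m - 1) {a : ℤ} (ha : ¬ (n : ℤ) ∣ a) :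
    HasConjLE 2 n a 1 ↔ ¬ HasConjLE 2 n (-a) (2 ^ (m - 1) - 1 - 1) := by
  have hqn := two_pow_modEq_one hn
  have h2m : 2 ^ m = 2 * 2 ^ (m - 1) := by rw [← pow_succ']; congr 1; lia
  have hp : 2 ≤ 2 ^ (m - 1) := Nat.le_self_pow (by lia) 2
  set d := 2 ^ (m - 1) - 1 with hd
  have hdm : (d : ℤ) * ((2 : ℕ) : ℤ) ≡ -1 [ZMOD n] :=
    ((Int.modEq_iff_dvd).2 ⟨1, by push_cast; lia⟩).symm
  constructor
  · rintro ⟨k, hk⟩ h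
    have hk0 := Int.emod_nonneg (a * ((2 : ℕ) : ℤ) ^ k) (show (n : ℤ) ≠ 0 by lia)
    have hk1 : (a * ((2 : ℕ) : ℤ) ^ k) % n = 1 := by
      have : (a * ((2 : ℕ) : ℤ) ^ k) % n ≠ 0 := fun h =>
        not_dvd_mul_pow hqn (by lia) ha k (Int.dvd_of_emod_eq_zero h)
      lia
    have h1 : a * ((2 : ℕ) : ℤ) ^ k ≡ 1 [ZMOD n] := by
      have := Int.mod_modEq (a * ((2 : ℕ) : ℤ) ^ k) n
      rw [hk1] at this
      exact this.symm
    have h2 : HasConjLE 2 n (-1) (d - 1) :=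
      (hasConjLE_congr hqn (by lia) (j := k) (by rw [neg_mul]; exact h1.neg.symm) _).1 h
    have h3 : HasConjLE 2 n d (d - 1) :=
      (hasConjLE_congr hqn (by lia) (j := 1) (by rw [pow_one]; exact hdm.symm) _).2 h2
    have := (isCosetLeader_two_pow_sub_one (by lia) hn).le_of_hasConjLE h3
    lia
  · intro h
    obtain ⟨l, hl, k, hk⟩ := exists_isCosetLeader (q := 2) (show 0 < n by lia) (-a)
    have h1 : l = d := by
      refine le_antisymm (hl.le_two_pow_sub_one (by lia) hn) ?_
      by_contra! hlt
      exact h ⟨k, by rw [hk]; lia⟩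
    have h2 : -a * ((2 : ℕ) : ℤ) ^ k ≡ d [ZMOD n] := by
      rw [← h1, ← hk]
      exact (Int.mod_modEq _ _).symm
    have h3 := ((h2.mul_right ((2 : ℕ) : ℤ)).trans hdm).neg
    rw [neg_neg, mul_assoc, ← pow_succ, neg_mul, neg_neg] at h3
    refine ⟨k + 1, ?_⟩
    rw [h3]
    exact emod_le_self_of_nonneg n zero_le_one

/-- No leader lies strictly between the two largest, so every such `D` gives the same condition. -/
theorem hasConjLE_second_iff (hm : 4 ≤ m) (hn : n = 2 ^ m - 1) {D : ℕ}
    (hD : 2 ^ (m - 1) - 2 ^ ((m - 1) / 2) - 1 ≤ D) (hD' : D < 2 ^ (m - 1) - 1) (a : ℤ) :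
    HasConjLE 2 n a D ↔ HasConjLE 2 n a (2 ^ (m - 1) - 1 - 1) := by
  refine ⟨fun h => h.mono (by lia), fun h => ?_⟩
  have hqn := two_pow_modEq_one hn
  have h2m : 2 ^ m = 2 * 2 ^ (m - 1) := by rw [← pow_succ']; congr 1; lia
  obtain ⟨l, hl, k, hk⟩ := exists_isCosetLeader (q := 2) (show 0 < n by lia) a
  have h1 : HasConjLE 2 n l (2 ^ (m - 1) - 1 - 1) :=
    (hasConjLE_congr hqn (by lia) (j := k) (by rw [← hk]; exact Int.mod_modEq _ _) _).1 h
  have h2 := hl.le_of_hasConjLE h1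
  refine ⟨k, ?_⟩
  rw [hk]
  exact_mod_cast (hl.le_second hm hn (by lia)).trans hD

end Binary

end BCH

end

/-! ### The theorem -/

theorem theorem4 {F K : Type*} [Field F] [Finite F] [Field K] [Algebra F K]
    (q m s n : ℕ) (hq : Nat.card F = q) (hK : Module.finrank F K = m)
    (hs : 1 ≤ s) (hsm : s ∣ m) (hms : 3 ≤ m / s)
    (hm : q ≠ 2 → 4 ≤ m) (hm2 : q = 2 → 6 ≤ m)
    (hn : n = (q ^ m - 1) / (q ^ s - 1))
    (β : K) (hβ : IsPrimitiveRoot β n)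
    (δ₁ : ℕ) (hδ₁ : IsGreatest {a | BCH.IsCosetLeader q n a} δ₁)
    (δ : ℕ) (hδ2 : 2 ≤ δ) (hδn : δ ≤ n) :
    (q = 2 ∧ s = 1 →
      IsGreatest {a | BCH.IsCosetLeader q n a ∧ a ≠ δ₁}
        (2 ^ (m - 1) - 2 ^ ((m - 1) / 2) - 1) ∧
      (BCH.IsDuallyBCH β (BCH.narrowBCHCode F n β δ) ↔
        δ = 2 ∨ δ = 3 ∨
          ((2 ^ (m - 1) - 2 ^ ((m - 1) / 2) - 1) + 1 ≤ δ ∧ δ ≤ n))) ∧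
    (2 < q ∨ 1 < s →
      (BCH.IsDuallyBCH β (BCH.narrowBCHCode F n β δ) ↔ δ₁ < δ ∧ δ ≤ n)) := by
  obtain ⟨r, rfl⟩ := hsm
  rw [Nat.mul_div_cancel_left r (by lia)] at hms
  have hq2 : 2 ≤ q := hq ▸ Finite.one_lt_card
  have hm0 : 0 < s * r := Nat.mul_pos (by lia) (by lia)
  have : FiniteDimensional F K := FiniteDimensional.of_finrank_pos (by lia)
  have hn0 : 0 < n := by lia
  have hQ : 2 ≤ q ^ s := hq2.trans (Nat.le_self_pow (by lia) q)
  have hnr : n = BCH.repunit (q ^ s) r := by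
    rw [hn, pow_mul, ← BCH.repunit_mul (q ^ s) r (by lia), Nat.add_sub_cancel,
      Nat.mul_div_cancel _ (by lia)]
  have hqn : (q : ℤ) ^ (s * r) ≡ 1 [ZMOD n] := by
    rw [hnr]
    exact BCH.pow_modEq_one_repunit (by lia)
  have hiff := BCH.isDuallyBCH_narrowBCHCode_iff (F := F) hβ hδ2 hδn
  rw [hq] at hiff
  rw [hiff]
  have hbig (h : δ₁ < δ) : ∃ v : ℕ, v + 2 ≤ n ∧ ∀ a : ℤ, ¬ (n : ℤ) ∣ a →
      (BCH.HasConjLE q n a v ↔ ¬ BCH.HasConjLE q n (-a) (δ - 1)) :=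
    ⟨0, by lia, fun a ha => BCH.exchange_of_lt hqn hm0 hn0 hδ₁.2 (by lia) ha⟩
  have hndvd {l : ℕ} (hl0 : 0 < l) (hl : BCH.IsCosetLeader q n l) : ¬ (n : ℤ) ∣ -(l : ℤ) := by
    rw [dvd_neg, Int.natCast_dvd_natCast]
    exact fun h => (Nat.le_of_dvd hl0 h).not_gt hl.1
  constructor
  · rintro ⟨rfl, rfl⟩
    rw [one_mul] at *
    have hr6 := hm2 rfl
    have hn' : n = 2 ^ r - 1 := by simpa using hn
    have hδ₁' : δ₁ = 2 ^ (r - 1) - 1 :=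
      le_antisymm (hδ₁.1.le_two_pow_sub_one (by lia) hn')
        (hδ₁.2 (BCH.isCosetLeader_two_pow_sub_one (by lia) hn'))
    have h2r : 2 ^ r = 2 * 2 ^ (r - 1) := by rw [← pow_succ']; congr 1; lia
    have he : 2 * 2 ^ ((r - 1) / 2) ≤ 2 ^ (r - 1) := by
      rw [← pow_succ']
      exact Nat.pow_le_pow_right (by lia) (by lia)
    have he0 : 1 ≤ 2 ^ ((r - 1) / 2) := Nat.one_le_two_pow
    have hlead := BCH.isCosetLeader_second (by lia) hn'
    have hsecond {a : ℕ} := BCH.IsCosetLeader.le_second (a := a) (show 4 ≤ r by lia) hn'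
    have hconj {D : ℕ} := BCH.hasConjLE_second_iff (D := D) (show 4 ≤ r by lia) hn'
    set δ₂ := 2 ^ (r - 1) - 2 ^ ((r - 1) / 2) - 1 with hδ₂
    rw [← hδ₁'] at hsecond hconj
    have hone {a : ℤ} (ha : ¬ (n : ℤ) ∣ a) := BCH.hasConjLE_one_iff (show 4 ≤ r by lia) hn' ha
    rw [← hδ₁'] at hone
    have hlt : δ₂ < δ₁ := by lia
    refine ⟨⟨⟨hlead, hlt.ne⟩, fun a ha => hsecond ha.1 ha.2⟩, ?_⟩
    constructor
    · rintro ⟨v, hv, H⟩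
      by_contra! hδ
      obtain ⟨hne2, hne3, hδ⟩ := hδ
      have hδδ₂ : δ ≤ δ₂ := by
        by_contra! h
        exact (hδ h).not_ge hδn
      have hnd := hndvd (by lia) hlead
      have h1 : BCH.HasConjLE 2 n (-(δ₂ : ℤ)) v := by
        rw [H _ hnd, neg_neg]
        intro h
        have := hlead.le_of_hasConjLE h
        lia
      -- If `v ≤ 2`, then `-δ₂` would be conjugate to `1`, and so `δ₂` to `δ₁`. Thus `v` and `δ - 1`
      -- both reach `3 = R_2`.
      have hv3 : 3 ≤ v := by
        by_contra! hlt3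
        have h2 := (BCH.hasConjLE_two_iff (by lia) hn' _).1 (h1.mono (show v ≤ 2 by lia))
        rw [hone hnd, neg_neg] at h2
        exact h2 ((BCH.hasConjLE_repunit δ₂).mono (by lia))
      obtain ⟨z, hz⟩ := BCH.exists_hasLargeConj_two_one hr6
      have h3 : BCH.repunit (2 ^ 1) 2 = 3 := by decide
      rw [hnr] at H
      exact BCH.not_exchange (s := 1) (t := 2) one_le_two (by lia) two_pos (by lia) (by lia)
        (by lia) z hz H
    · intro hδ
      rcases lt_or_ge δ₁ δ with h | h
      · exact hbig h
      have hneg {a : ℤ} (ha : ¬ (n : ℤ) ∣ a) :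
          BCH.HasConjLE 2 n a (δ₁ - 1) ↔ ¬ BCH.HasConjLE 2 n (-a) 1 := by
        rw [hone (by rwa [dvd_neg]), neg_neg, not_not]
      rcases hδ with rfl | rfl | ⟨hδ, -⟩
      · exact ⟨δ₁ - 1, by lia, fun a ha => hneg ha⟩
      · refine ⟨δ₁ - 1, by lia, fun a ha => ?_⟩
        rw [hneg ha, ← BCH.hasConjLE_two_iff (by lia) hn']
      -- Only the coset of `δ₁` is missed by the code, so the dual's exponents are `0` and the coset
      -- of `1`.
      · refine ⟨1, by lia, fun a ha => ?_⟩
        rw [hone ha, hconj (D := δ - 1) (by lia) (by lia)]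
  · intro hqs
    refine ⟨?_, fun h => hbig h.1⟩
    rintro ⟨v, hv, H⟩
    refine ⟨?_, hδn⟩
    by_contra! h
    have hnd := hndvd (by lia) hδ₁.1
    have h1 : BCH.HasConjLE q n (-(δ₁ : ℤ)) v := by
      rw [H _ hnd, neg_neg]
      intro h
      have := hδ₁.1.le_of_hasConjLE h
      lia
    -- As `δ ≤ δ₁`, the coset of `-δ₁` has to meet `[0, v]`, which forces `v ≥ 1 = R_1`.
    have hv1 := BCH.pos_of_hasConjLE hqn hm0 hn0 hnd h1
    obtain ⟨z, hz⟩ : ∃ z, BCH.HasLargeConj q s r 1 z := by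
      rcases hq2.eq_or_lt with rfl | hq3
      · exact BCH.exists_hasLargeConj_two (by lia) hms
      · rcases hs.eq_or_lt with rfl | hs2
        · exact BCH.exists_hasLargeConj_one hq3 (by rw [← one_mul r]; exact hm (by lia))
        · exact BCH.exists_hasLargeConj hq3 hs2 hms
    have h3 : BCH.repunit (q ^ s) 1 = 1 := by simp [BCH.repunit]
    rw [hnr] at H
    exact BCH.not_exchange (t := 1) (by lia) (by lia) one_pos (by lia) (by lia) (by lia) z hz H
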